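/- Let $G$ be a locally compact Hausdorff group with a (left, regular) Haar measure $\mu$, let $A$ be a complex Banach algebra (not necessarily unital), and suppose that the dual $A^*$ has the Radon–Nikodym property: for every $\sigma$-finite measure space $(S,\nu)$, every $A^*$-valued measure $F$ on $S$ of bounded variation with $F\ll\nu$ is of the form $F(E)=\int_E\phi\,d\nu$ with some $\phi\in L^1(S,\nu;A^*)$. For a Banach algebra $B$ the two Arens products on $B^{**}$ are $(m\Box n)(f)=m({}_nf)$ and $(m\diamond n)(f)=n(f_m)$, where for $f\in B^*$, $a,b\in B$ one puts $f_a(b)=f(ab)$, ${}_af(b)=f(ba)$, ${}_nf(a)=n(f_a)$, $f_m(a)=m({}_af)$. The space $L^1(G,B)$ is a Banach algebra under convolution $(\phi*\psi)(t)=\int_G\phi(s)\psi(s^{-1}t)\,d\mu(s)$. Let $L^\infty(G,A^*)$ be the space of strongly measurable, essentially bounded functions $G\to A^*$ (if $G$ is not $\sigma$-compact: functions that are strongly measurable on every compact set and bounded by a common constant almost everywhere on every compact set); each $f\in L^\infty(G,A^*)$ is regarded as the functional $g\mapsto\int_G\langle f(t),g(t)\rangle\,d\mu(t)$ on $L^1(G,A)$.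 Then every bounded linear functional on $L^1(G,A)$ is given in this way by some $f\in L^\infty(G,A^*)$, and there is exactly one map $\theta:L^1(G,A^{**})\to L^1(G,A)^{**}$ with $$\theta(\phi)(f)=\int_G\langle f(t),\phi(t)\rangle\,d\mu(t)\qquad(\phi\in L^1(G,A^{**}),\ f\in L^\infty(G,A^*)).$$ This map is linear and isometric, and it is an algebra homomorphism both as a map $\theta_\Box:L^1(G,(A^{**},\Box))\to(L^1(G,A)^{**},\Box)$ and as a map $\theta_\diamond:L^1(G,(A^{**},\diamond))\to(L^1(G,A)^{**},\diamond)$. -/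

import Mathlib

open MeasureTheory Filter Topology

set_option maxSynthPendingDepth 3

set_option linter.unusedSectionVars false

namespace ArensGroup

section Series
variable {α : Type*} [MeasurableSpace α] {μ : Measure α} {E : Type*} [NormedAddCommGroup E]

lemma ae_summable_norm {ι : Type*} [Countable ι] {F : ι → α → E}
    (hF : ∀ i, Integrable (F i) μ) (hs : Summable fun i => ∫ a, ‖F i a‖ ∂μ) :
    ∀ᵐ a ∂μ, Summable fun i => ‖F i a‖ := by
  have h1 : ∫⁻ a, ∑' i, ‖F i a‖ₑ ∂μ ≠ ⊤ := by
    rw [lintegral_tsum (fun i => (hF i).1.enorm)]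
    have (i : ι) : ∫⁻ a, ‖F i a‖ₑ ∂μ = ENNReal.ofReal (∫ a, ‖F i a‖ ∂μ) :=
      (ofReal_integral_norm_eq_lintegral_enorm (hF i)).symm
    simp_rw [this]
    exact hs.tsum_ofReal_ne_top
  filter_upwards [ae_lt_top' (AEMeasurable.tsum fun i => (hF i).1.enorm) h1] with a ha
  have := ENNReal.summable_toReal ha.ne
  simpa using this

lemma integrable_tsum_of_summable [CompleteSpace E] {ι : Type*} [Countable ι] {F : ι → α → E}
    (hF : ∀ i, Integrable (F i) μ) (hs : Summable fun i => ∫ a, ‖F i a‖ ∂μ) :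
    Integrable (fun a => ∑' i, F i a) μ ∧
      ∫ a, ‖∑' i, F i a‖ ∂μ ≤ ∑' i, ∫ a, ‖F i a‖ ∂μ := by
  have hae := ae_summable_norm hF hs
  have hn := hasSum_integral_of_summable_integral_norm (F := fun i a => ‖F i a‖)
    (fun i => (hF i).norm) (by simpa using hs)
  have hint : Integrable (fun a => ∑' i, ‖F i a‖) μ := by
    refine ⟨(AEMeasurable.tsum fun i => (hF i).1.norm.aemeasurable).aestronglyMeasurable, ?_⟩
    have h1 : ∫⁻ a, ∑' i, ‖F i a‖ₑ ∂μ < ⊤ := by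
      rw [lintegral_tsum (fun i => (hF i).1.enorm)]
      have (i : ι) : ∫⁻ a, ‖F i a‖ₑ ∂μ = ENNReal.ofReal (∫ a, ‖F i a‖ ∂μ) :=
        (ofReal_integral_norm_eq_lintegral_enorm (hF i)).symm
      simp_rw [this]
      exact hs.tsum_ofReal_lt_top
    refine lt_of_le_of_lt (lintegral_mono fun a => ?_) h1
    simpa using enorm_tsum_le_tsum_enorm (f := fun i => ‖F i a‖)
  have hle : ∀ᵐ a ∂μ, ‖∑' i, F i a‖ ≤ ∑' i, ‖F i a‖ := by
    filter_upwards [hae] with a ha using norm_tsum_le_tsum_norm ha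
  have hm : AEStronglyMeasurable (fun a => ∑' i, F i a) μ := by
    have hlim : ∀ᵐ a ∂μ, Tendsto (fun s : Finset ι => ∑ i ∈ s, F i a) atTop
        (𝓝 (∑' i, F i a)) := by
      filter_upwards [hae] with a ha using ha.of_norm.hasSum
    exact aestronglyMeasurable_of_tendsto_ae _
      (fun s => Finset.aestronglyMeasurable_fun_sum s fun i _ => (hF i).1) hlim
  have hi : Integrable (fun a => ∑' i, F i a) μ :=
    hint.mono' hm hle
  refine ⟨hi, ?_⟩
  rw [hn.tsum_eq]
  exact integral_mono_ae hi.norm hint hle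

end Series

section Group
variable {G : Type*} [TopologicalSpace G] [Group G] [IsTopologicalGroup G] [LocallyCompactSpace G]
  [T2Space G] [MeasurableSpace G] [BorelSpace G] {μ : Measure G}
  {E : Type*} [NormedAddCommGroup E]

lemma exists_cc_approx [NormedSpace ℝ E] [μ.Regular] {f : G → E} (hf : Integrable f μ) {ε : ℝ}
    (hε : 0 < ε) :
    ∃ h : G → E, HasCompactSupport h ∧ (∫ x, ‖f x - h x‖ ∂μ) ≤ ε ∧ Continuous h ∧
      Integrable h μ := by
  obtain ⟨h, h1, h2, h3⟩ : ∃ h : G → E, eLpNorm (f - h) 1 μ ≤ ENNReal.ofReal ε ∧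
      Continuous h ∧ HasCompactSupport h := by
    have hf' : MemLp f 1 μ := memLp_one_iff_integrable.2 hf
    have hε' : ENNReal.ofReal ε ≠ 0 := by simpa using hε
    refine MemLp.induction_dense ENNReal.one_ne_top
      (fun h : G → E => Continuous h ∧ HasCompactSupport h) ?_ ?_ ?_ hf' hε'
    rotate_left
    · exact fun f g hf hg => ⟨hf.1.add hg.1, hf.2.add hg.2⟩
    · exact fun f hf => (Continuous.integrable_of_hasCompactSupport hf.1 hf.2).1
    intro c s hs hμs δ hδ
    obtain ⟨η, hη0, hη⟩ : ∃ η : ENNReal, η ≠ 0 ∧ (η + η) * ‖c‖ₑ ≤ δ := by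
      refine ⟨δ / (2 * (1 + ‖c‖ₑ)), by simp [hδ, ENNReal.mul_eq_top], ?_⟩
      rw [← two_mul]
      calc 2 * (δ / (2 * (1 + ‖c‖ₑ))) * ‖c‖ₑ
          ≤ 2 * (δ / (2 * (1 + ‖c‖ₑ))) * (1 + ‖c‖ₑ) := by gcongr; exact le_add_self
        _ = (δ / (2 * (1 + ‖c‖ₑ))) * (2 * (1 + ‖c‖ₑ)) := by ring
        _ = δ := ENNReal.div_mul_cancel (by simp) (by finiteness)
    obtain ⟨K, hKs, hK, hμK⟩ := hs.exists_isCompact_sdiff_lt hμs.ne hη0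
    obtain ⟨U, hsU, hU, -, hμU⟩ := hs.exists_isOpen_sdiff_lt hμs.ne hη0
    obtain ⟨φ, φ1, φ2, φ3, φ4⟩ :=
      exists_continuousMap_one_of_isCompact_subset_isOpen hK hU (hKs.trans hsU)
    refine ⟨fun x => φ x • c, ?_, by fun_prop, HasCompactSupport.smul_right φ2⟩
    rw [eLpNorm_one_eq_lintegral_enorm]
    have hm : MeasurableSet (U \ s ∪ s \ K) :=
      (hU.measurableSet.diff hs).union (hs.diff hK.measurableSet)
    calc ∫⁻ x, ‖((fun x => φ x • c) - s.indicator fun _ => c) x‖ₑ ∂μ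
        ≤ ∫⁻ x, (U \ s ∪ s \ K).indicator (fun _ => ‖c‖ₑ) x ∂μ := by
          refine lintegral_mono fun x => ?_
          by_cases hxs : x ∈ s
          · by_cases hxK : x ∈ K
            · have : φ x = 1 := φ1 hxK
              simp [hxs, this]
            · have hx : x ∈ U \ s ∪ s \ K := Or.inr ⟨hxs, hxK⟩
              have e : φ x • c - c = (φ x - 1) • c := by rw [sub_smul, one_smul]
              rw [Set.indicator_of_mem hx, Pi.sub_apply, Set.indicator_of_mem hxs, e, enorm_smul]
              have : ‖φ x - 1‖ₑ ≤ 1 := by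
                rw [← ofReal_norm, ENNReal.ofReal_le_one, Real.norm_eq_abs, abs_le]
                constructor <;> linarith [(φ4 x).1, (φ4 x).2]
              exact mul_le_of_le_one_left' this
          · by_cases hxU : x ∈ U
            · have hx : x ∈ U \ s ∪ s \ K := Or.inl ⟨hxU, hxs⟩
              rw [Set.indicator_of_mem hx, Pi.sub_apply, Set.indicator_of_notMem hxs, sub_zero,
                enorm_smul]
              have : ‖φ x‖ₑ ≤ 1 := by
                rw [← ofReal_norm, ENNReal.ofReal_le_one, Real.norm_eq_abs, abs_le]
                constructor <;> linarith [(φ4 x).1, (φ4 x).2]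
              exact mul_le_of_le_one_left' this
            · have : φ x = 0 := image_eq_zero_of_notMem_tsupport fun h => hxU (φ3 h)
              simp [hxs, this]
      _ = ‖c‖ₑ * μ (U \ s ∪ s \ K) := by rw [lintegral_indicator_const hm]
      _ ≤ ‖c‖ₑ * (η + η) := by
          gcongr
          exact (measure_union_le _ _).trans (add_le_add hμU.le hμK.le)
      _ ≤ δ := by rwa [mul_comm]
  have h4 := h2.integrable_of_hasCompactSupport h3 (μ := μ)
  refine ⟨h, h3, ?_, h2, h4⟩
  rw [eLpNorm_one_eq_lintegral_enorm] at h1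
  have := ofReal_integral_norm_eq_lintegral_enorm (hf.sub h4)
  simp only [Pi.sub_apply] at this h1
  rw [← this] at h1
  exact (ENNReal.ofReal_le_ofReal_iff hε.le).1 h1

lemma exists_series [NormedSpace ℝ E] [CompleteSpace E] [μ.Regular] {g : G → E} (hg : Integrable g μ) :
    ∃ v : ℕ → G → E, (∀ n, Continuous (v n)) ∧ (∀ n, HasCompactSupport (v n)) ∧
      (Summable fun n => ∫ t, ‖v n t‖ ∂μ) ∧ (∑' n, ∫ t, ‖v n t‖ ∂μ ≤ 3 * ∫ t, ‖g t‖ ∂μ) ∧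
      ∀ᵐ t ∂μ, (Summable fun n => ‖v n t‖) ∧ HasSum (fun n => v n t) (g t) := by
  rcases (integral_nonneg (fun t => norm_nonneg (g t)) : 0 ≤ ∫ t, ‖g t‖ ∂μ).eq_or_lt with h0 | h0
  · refine ⟨fun _ _ => 0, fun _ => continuous_const, fun _ => HasCompactSupport.zero, ?_, ?_, ?_⟩
    · simp [summable_zero]
    · simp [← h0]
    · rw [eq_comm, integral_eq_zero_iff_of_nonneg (fun t => norm_nonneg _) hg.norm] at h0
      filter_upwards [h0] with t ht
      have : g t = 0 := by simpa using ht
      simp [this, hasSum_zero, summable_zero]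
  set c := ∫ t, ‖g t‖ ∂μ with hc
  have key : ∀ n : ℕ, ∃ h : G → E, HasCompactSupport h ∧ (∫ t, ‖g t - h t‖ ∂μ) ≤ c * (1 / 2) ^ n ∧
      Continuous h ∧ Integrable h μ ∧ (n = 0 → h = 0) := by
    intro n
    rcases n with _ | n
    · exact ⟨0, HasCompactSupport.zero, by simp [hc], continuous_const, integrable_zero _ _ _,
        fun _ => rfl⟩
    · obtain ⟨h, h1, h2, h3, h4⟩ := exists_cc_approx hg
        (ε := c * (1 / 2) ^ (n + 1)) (by positivity)
      exact ⟨h, h1, h2, h3, h4, by simp⟩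
  choose h h1 h2 h3 h4 h5 using key
  have hgeo : Summable fun n : ℕ => c * (1 / 2 : ℝ) ^ n := summable_geometric_two.mul_left c
  have hd : Summable fun n => ∫ t, ‖g t - h n t‖ ∂μ :=
    Summable.of_nonneg_of_le (fun n => integral_nonneg fun t => norm_nonneg _) h2 hgeo
  have hb : ∀ n, ∫ t, ‖h (n + 1) t - h n t‖ ∂μ ≤ (3 / 2 * c) * (1 / 2) ^ n := by
    intro n
    have : ∫ t, ‖h (n + 1) t - h n t‖ ∂μ ≤
        ∫ t, (‖g t - h n t‖ + ‖g t - h (n + 1) t‖) ∂μ := by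
      refine integral_mono ((h4 _).sub (h4 _)).norm
        ((hg.sub (h4 _)).norm.add (hg.sub (h4 _)).norm) fun t => ?_
      have := norm_sub_le (g t - h n t) (g t - h (n + 1) t)
      simpa using this
    have hadd := integral_add (hg.sub (h4 n)).norm (hg.sub (h4 (n + 1))).norm
    simp only [Pi.sub_apply] at hadd
    rw [hadd] at this
    have e1 := h2 n
    have e2 := h2 (n + 1)
    rw [pow_succ] at e2
    linarith
  have hgeo' : Summable fun n : ℕ => (3 / 2 * c) * (1 / 2 : ℝ) ^ n :=
    summable_geometric_two.mul_left _
  have hvs : Summable fun n => ∫ t, ‖h (n + 1) t - h n t‖ ∂μ :=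
    Summable.of_nonneg_of_le (fun n => integral_nonneg fun t => norm_nonneg _) hb hgeo'
  refine ⟨fun n t => h (n + 1) t - h n t, fun n => (h3 _).sub (h3 _),
    fun n => (h1 _).sub (h1 _), hvs, ?_, ?_⟩
  · refine (hvs.tsum_le_tsum hb hgeo').trans (le_of_eq ?_)
    rw [tsum_mul_left, tsum_geometric_two]
    ring
  · filter_upwards [ae_summable_norm (fun n => hg.sub (h4 n)) hd,
      ae_summable_norm (fun n => (h4 (n + 1)).sub (h4 n)) hvs] with t ht1 ht2
    refine ⟨ht2, ?_⟩
    have hs : Summable fun n => h (n + 1) t - h n t := Summable.of_norm ht2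
    have hlim : Tendsto (fun n => ∑ i ∈ Finset.range n, (h (i + 1) t - h i t)) atTop
        (𝓝 (g t)) := by
      have : ∀ n, ∑ i ∈ Finset.range n, (h (i + 1) t - h i t) = h n t := by
        intro n
        rw [Finset.sum_range_sub (fun i => h i t), h5 0 rfl]
        simp
      simp_rw [this]
      have h0 := ht1.tendsto_atTop_zero
      have h0' := tendsto_zero_iff_norm_tendsto_zero.2 h0
      simpa using (tendsto_const_nhds (x := g t)).sub h0'
    exact tendsto_nhds_unique hs.hasSum.tendsto_sum_nat hlim ▸ hs.hasSum


lemma inv_absolutelyContinuous (μ : Measure G) [μ.IsHaarMeasure] [μ.Regular] : μ.inv ≪ μ := by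
  obtain ⟨g, g2, g3, g4⟩ : ∃ g : C(G, ℝ), HasCompactSupport g ∧ 0 ≤ g ∧ g 1 ≠ 0 :=
    exists_continuous_nonneg_pos (1 : G)
  set c := ∫ x, g x ∂μ with hc
  have hcpos : 0 < c := g.continuous.integral_pos_of_hasCompactSupport_nonneg_nonzero g2 g3 g4
  set D : G → ℝ := fun y => ∫ z, g (z⁻¹ * y) ∂μ.inv with hD
  have D_cont : Continuous D := continuous_integral_apply_inv_mul g.continuous g2
  have D_pos : ∀ x, 0 < D x := fun x =>
    (g.continuous.comp (by fun_prop : Continuous fun z : G => z⁻¹ * x)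
      ).integral_pos_of_hasCompactSupport_nonneg_nonzero
      (g2.comp_homeomorph ((Homeomorph.inv G).trans (Homeomorph.mulRight x)))
      (fun z => g3 _) (x := x) (by simpa using g4)
  have key : ∀ φ : G → ℝ, Continuous φ → HasCompactSupport φ →
      ∫ x, φ x ∂μ.inv = ∫ x, φ x * (D x / c) ∂μ := by
    intro φ h1 h2
    have := Measure.integral_isMulLeftInvariant_isMulRightInvariant_combo (μ := μ) (ν := μ.inv)
      (f := fun x => φ x * (D x / c)) (by fun_prop) h2.mul_right g.continuous g2 g3 g4
    rw [this, ← hc, ← integral_mul_const]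
    refine integral_congr_ae (Eventually.of_forall fun x => ?_)
    have := (D_pos x).ne'
    simp only [hD] at this ⊢
    field_simp
  have hopen : ∀ V : Set G, IsOpen V → μ.inv V ≤ ∫⁻ x in V, ENNReal.ofReal (D x / c) ∂μ := by
    intro V hV
    rw [hV.measure_eq_iSup_isCompact]
    refine iSup₂_le fun K hKV => iSup_le fun hK => ?_
    obtain ⟨φ, φ1, φ2, φ3, φ4⟩ := exists_continuousMap_one_of_isCompact_subset_isOpen hK hV hKV
    have hi : Integrable φ μ.inv := φ.continuous.integrable_of_hasCompactSupport φ2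
    have hi' : Integrable (fun x => φ x * (D x / c)) μ :=
      Continuous.integrable_of_hasCompactSupport (by fun_prop)
        (HasCompactSupport.mul_right φ2)
    calc μ.inv K = ∫⁻ x in K, 1 ∂μ.inv := by simp
      _ ≤ ∫⁻ x in K, ENNReal.ofReal (φ x) ∂μ.inv := by
          refine setLIntegral_mono' hK.measurableSet fun x hx => ?_
          simp [φ1 hx]
      _ ≤ ∫⁻ x, ENNReal.ofReal (φ x) ∂μ.inv := setLIntegral_le_lintegral _ _
      _ = ENNReal.ofReal (∫ x, φ x ∂μ.inv) :=
          (ofReal_integral_eq_lintegral_ofReal hi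
            (Eventually.of_forall fun x => (φ4 x).1)).symm
      _ = ENNReal.ofReal (∫ x, φ x * (D x / c) ∂μ) := by rw [key φ φ.continuous φ2]
      _ = ∫⁻ x, ENNReal.ofReal (φ x * (D x / c)) ∂μ :=
          ofReal_integral_eq_lintegral_ofReal hi'
            (Eventually.of_forall fun x =>
              mul_nonneg (φ4 x).1 (div_nonneg (D_pos x).le hcpos.le))
      _ ≤ ∫⁻ x, V.indicator (fun x => ENNReal.ofReal (D x / c)) x ∂μ := by
          refine lintegral_mono fun x => ?_
          by_cases hx : x ∈ V
          · rw [Set.indicator_of_mem hx]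
            refine ENNReal.ofReal_le_ofReal (mul_le_of_le_one_left ?_ (φ4 x).2)
            exact div_nonneg (D_pos x).le hcpos.le
          · have : φ x = 0 := image_eq_zero_of_notMem_tsupport fun h => hx (φ3 h)
            simp [this]
      _ = ∫⁻ x in V, ENNReal.ofReal (D x / c) ∂μ := lintegral_indicator hV.measurableSet _
  intro N hN
  have hk : ∀ k : ℕ, μ.inv (N ∩ {x | D x / c < k}) = 0 := by
    intro k
    refine le_antisymm (ENNReal.le_of_forall_pos_le_add fun ε hε _ => ?_) zero_le
    have hε' : (ε : ENNReal) / (k + 1) ≠ 0 := by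
      simp [hε.ne', ENNReal.div_eq_zero_iff]
    obtain ⟨U, hNU, hU, hUμ⟩ := N.exists_isOpen_lt_of_lt (μ := μ) ((ε : ENNReal) / (k + 1))
      (by rw [hN]; exact pos_iff_ne_zero.2 hε')
    have hM : IsOpen {x | D x / c < k} := isOpen_lt (by fun_prop) continuous_const
    calc μ.inv (N ∩ {x | D x / c < k}) ≤ μ.inv (U ∩ {x | D x / c < k}) := by gcongr
      _ ≤ ∫⁻ x in U ∩ {x | D x / c < k}, ENNReal.ofReal (D x / c) ∂μ := hopen _ (hU.inter hM)
      _ ≤ ∫⁻ x in U ∩ {x | D x / c < k}, (k + 1 : ENNReal) ∂μ := by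
          refine setLIntegral_mono' (hU.inter hM).measurableSet fun x hx => ?_
          have h1 : D x / c ≤ k := hx.2.le
          refine (ENNReal.ofReal_le_ofReal h1).trans ?_
          simp
      _ ≤ (k + 1) * μ U := by
          rw [setLIntegral_const]
          gcongr
          exact Set.inter_subset_left
      _ ≤ (k + 1) * (ε / (k + 1)) := by gcongr
      _ = 0 + ε := by rw [zero_add, ENNReal.mul_div_cancel (by simp) (by finiteness)]
  have hcover : N ⊆ ⋃ k : ℕ, N ∩ {x | D x / c < k} := fun x hx => by
    obtain ⟨k, hk⟩ := exists_nat_gt (D x / c)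
    exact Set.mem_iUnion.2 ⟨k, hx, hk⟩
  exact measure_mono_null hcover (measure_iUnion_null hk)

lemma ae_inv_mul {p : G → Prop} [μ.IsHaarMeasure] [μ.Regular] (hp : ∀ᵐ x ∂μ, p x) (t : G) :
    ∀ᵐ s ∂μ, p (s⁻¹ * t) := by
  have h1 : ∀ᵐ s ∂μ, p s⁻¹ := by
    have := (inv_absolutelyContinuous μ).ae_le hp
    exact ((MeasurableEquiv.inv G).measurableEmbedding.ae_map_iff (μ := μ)).1 this
  have h2 := ((measurePreserving_mul_left μ t⁻¹).quasiMeasurePreserving.ae h1)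
  filter_upwards [h2] with s hs
  simpa using hs

lemma integrable_cc {H : Type*} [NormedAddCommGroup H] [NormedSpace ℝ H]
    [IsFiniteMeasureOnCompacts μ] {k : G → G → H}
    (hk : Continuous k.uncurry) (hc : HasCompactSupport k.uncurry) :
    (∀ t, Integrable (fun s => k s t) μ) ∧ Integrable (fun t => ∫ s, k s t ∂μ) μ := by
  have hK1 : IsCompact (Prod.fst '' tsupport k.uncurry) := IsCompact.image hc continuous_fst
  have hK2 : IsCompact (Prod.snd '' tsupport k.uncurry) := IsCompact.image hc continuous_snd
  have z1 : ∀ s t, s ∉ Prod.fst '' tsupport k.uncurry → k s t = 0 := fun s t hs =>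
    image_eq_zero_of_notMem_tsupport (f := k.uncurry) fun h => hs ⟨(s, t), h, rfl⟩
  have z2 : ∀ s t, t ∉ Prod.snd '' tsupport k.uncurry → k s t = 0 := fun s t ht =>
    image_eq_zero_of_notMem_tsupport (f := k.uncurry) fun h => ht ⟨(s, t), h, rfl⟩
  refine ⟨fun t => Continuous.integrable_of_hasCompactSupport
    (hk.comp (by fun_prop : Continuous fun s : G => (s, t)))
    (HasCompactSupport.intro hK1 fun s hs => z1 s t hs), ?_⟩
  refine Continuous.integrable_of_hasCompactSupport ?_
    (HasCompactSupport.intro hK2 fun t ht => ?_)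
  · rw [← continuousOn_univ]
    refine continuousOn_integral_of_compact_support (f := fun t s => k s t) hK1 ?_
      fun t s _ hs => z1 s t hs
    exact (hk.comp continuous_swap).continuousOn
  · simp [fun s => z2 s t ht]

lemma continuous_cc {H : Type*} [NormedAddCommGroup H] {u v : G → E} {b : E → E → H}
    (hb : Continuous b.uncurry) (hb0 : ∀ x, b x 0 = 0) (hb0' : ∀ x, b 0 x = 0)
    (hu : Continuous u) (hu' : HasCompactSupport u) (hv : Continuous v)
    (hv' : HasCompactSupport v) :
    Continuous (Function.uncurry fun s t => b (u s) (v (s⁻¹ * t))) ∧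
      HasCompactSupport (Function.uncurry fun s t => b (u s) (v (s⁻¹ * t))) := by
  constructor
  · exact hb.comp (f := fun p : G × G => (u p.1, v (p.1⁻¹ * p.2))) (by fun_prop)
  · refine HasCompactSupport.intro (IsCompact.prod hu' (IsCompact.mul hu' hv')) ?_
    rintro ⟨s, t⟩ h
    by_cases hs : s ∈ tsupport u
    · have ht : s⁻¹ * t ∉ tsupport v := fun ht => h ⟨hs, by
        simpa using Set.mul_mem_mul hs ht⟩
      simp [Function.uncurry, image_eq_zero_of_notMem_tsupport ht, hb0]
    · simp [Function.uncurry, image_eq_zero_of_notMem_tsupport hs, hb0']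


/-- The convolution `t ↦ ∫ f(s) g(s⁻¹t) dμ(s)` of two functions with values in a space with
multiplication `B`. -/
noncomputable def convFun [NormedSpace ℂ E] (μ : Measure G) (B : E →L[ℂ] E →L[ℂ] E)
    (f g : G → E) (t : G) : E :=
  ∫ s, B (f s) (g (s⁻¹ * t)) ∂μ

lemma convFun_aux [NormedSpace ℂ E] [CompleteSpace E] [μ.IsHaarMeasure] [μ.Regular]
    (B : E →L[ℂ] E →L[ℂ] E) {f g : G → E} (hf : Integrable f μ) (hg : Integrable g μ) :
    (∀ᵐ t ∂μ, Integrable (fun s => B (f s) (g (s⁻¹ * t))) μ) ∧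
      Integrable (convFun μ B f g) μ ∧
      ∫ t, ‖convFun μ B f g t‖ ∂μ ≤ 9 * ‖B‖ * (∫ t, ‖f t‖ ∂μ) * ∫ t, ‖g t‖ ∂μ := by
  obtain ⟨u, u1, u2, u3, u4, u5⟩ := exists_series hf
  obtain ⟨v, v1, v2, v3, v4, v5⟩ := exists_series hg
  set P : ℕ × ℕ → G → G → E := fun p s t => B (u p.1 s) (v p.2 (s⁻¹ * t)) with hP
  set J : ℕ × ℕ → G → G → ℝ := fun p s t => ‖u p.1 s‖ * ‖v p.2 (s⁻¹ * t)‖ with hJ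
  have P_cc : ∀ p, Continuous (P p).uncurry ∧ HasCompactSupport (P p).uncurry := fun p =>
    continuous_cc (b := fun x y => B x y)
      (by simp only [Function.uncurry_def]; fun_prop) (by simp) (by simp)
      (u1 _) (u2 _) (v1 _) (v2 _)
  have J_cc : ∀ p, Continuous (J p).uncurry ∧ HasCompactSupport (J p).uncurry := fun p =>
    continuous_cc (b := fun x y => ‖x‖ * ‖y‖)
      (by simp only [Function.uncurry_def]; fun_prop) (by simp) (by simp)
      (u1 _) (u2 _) (v1 _) (v2 _)
  have P_int := fun p => integrable_cc (μ := μ) (P_cc p).1 (P_cc p).2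
  have J_int := fun p => integrable_cc (μ := μ) (J_cc p).1 (J_cc p).2
  have J_nonneg : ∀ p s t, 0 ≤ J p s t := fun p s t => by positivity
  have J_nonneg' : ∀ p t, 0 ≤ ∫ s, J p s t ∂μ := fun p t => integral_nonneg fun s => J_nonneg _ _ _
  have J_val : ∀ p, ∫ t, ∫ s, J p s t ∂μ ∂μ =
      (∫ s, ‖u p.1 s‖ ∂μ) * ∫ t, ‖v p.2 t‖ ∂μ := by
    intro p
    rw [← integral_integral_swap_of_hasCompactSupport (J_cc p).1 (J_cc p).2,
      ← integral_mul_const]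
    congr 1 with s
    simp only [hJ]
    rw [integral_const_mul, integral_mul_left_eq_self (fun t => ‖v p.2 t‖) s⁻¹]
  have hun : ∀ n, 0 ≤ ∫ s, ‖u n s‖ ∂μ := fun n => integral_nonneg fun _ => norm_nonneg _
  have hvn : ∀ n, 0 ≤ ∫ s, ‖v n s‖ ∂μ := fun n => integral_nonneg fun _ => norm_nonneg _
  have J_sum : Summable fun p => ∫ t, ∫ s, J p s t ∂μ ∂μ := by
    simp_rw [J_val]
    exact u3.mul_of_nonneg v3 hun hvn
  have PJ : ∀ p s t, ‖P p s t‖ ≤ ‖B‖ * J p s t := fun p s t => by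
    have := B.le_opNorm₂ (u p.1 s) (v p.2 (s⁻¹ * t))
    rwa [mul_assoc] at this
  have PJ' : ∀ p t, ∫ s, ‖P p s t‖ ∂μ ≤ ‖B‖ * ∫ s, J p s t ∂μ := fun p t => by
    rw [← integral_const_mul]
    exact integral_mono ((P_int p).1 t).norm (((J_int p).1 t).const_mul _) fun s => PJ p s t
  have PJ'' : ∀ p, ∫ t, ‖∫ s, P p s t ∂μ‖ ∂μ ≤ ‖B‖ * ∫ t, ∫ s, J p s t ∂μ ∂μ := fun p => by
    rw [← integral_const_mul]
    exact integral_mono (P_int p).2.norm ((J_int p).2.const_mul _) fun t =>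
      (norm_integral_le_integral_norm _).trans (PJ' p t)
  have P_sum : Summable fun p => ∫ t, ‖∫ s, P p s t ∂μ‖ ∂μ :=
    Summable.of_nonneg_of_le (fun p => integral_nonneg fun _ => norm_nonneg _) PJ''
      (J_sum.mul_left _)
  have hae : ∀ᵐ t ∂μ, Summable fun p => ∫ s, J p s t ∂μ := by
    have := ae_summable_norm (F := fun p t => ∫ s, J p s t ∂μ) (fun p => (J_int p).2)
      (by simpa [Real.norm_of_nonneg (J_nonneg' _ _)] using J_sum)
    filter_upwards [this] with t ht
    simpa [Real.norm_of_nonneg (J_nonneg' _ _)] using ht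
  have hmain : ∀ᵐ t ∂μ, Integrable (fun s => B (f s) (g (s⁻¹ * t))) μ ∧
      convFun μ B f g t = ∑' p, ∫ s, P p s t ∂μ := by
    filter_upwards [hae] with t ht
    have hs : Summable fun p => ∫ s, ‖P p s t‖ ∂μ :=
      Summable.of_nonneg_of_le (fun p => integral_nonneg fun _ => norm_nonneg _)
        (fun p => PJ' p t) (ht.mul_left _)
    have h1 := integrable_tsum_of_summable (fun p => (P_int p).1 t) hs
    have h2 := hasSum_integral_of_summable_integral_norm (fun p => (P_int p).1 t) hs
    have h3 : (fun s => ∑' p, P p s t) =ᵐ[μ] fun s => B (f s) (g (s⁻¹ * t)) := by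
      filter_upwards [u5, ae_inv_mul v5 t] with s hus hvs
      have hsum : Summable fun p : ℕ × ℕ => P p s t := by
        refine Summable.of_norm_bounded ?_ (fun p => PJ p s t)
        exact (hus.1.mul_of_nonneg hvs.1 (fun _ => norm_nonneg _)
          fun _ => norm_nonneg _).mul_left _
      have e1 := hsum.hasSum.prod_fiberwise (fun n => (B (u n s)).hasSum hvs.2)
      have e2 := (B.flip (g (s⁻¹ * t))).hasSum hus.2
      exact e1.unique e2
    refine ⟨h1.1.congr h3, ?_⟩
    rw [convFun, ← integral_congr_ae h3, h2.tsum_eq]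
  have hconv := integrable_tsum_of_summable (fun p => (P_int p).2) P_sum
  have hcong : convFun μ B f g =ᵐ[μ] fun t => ∑' p, ∫ s, P p s t ∂μ := hmain.mono fun t ht => ht.2
  refine ⟨hmain.mono fun t ht => ht.1, hconv.1.congr hcong.symm, ?_⟩
  have hcongn : (fun t => ‖convFun μ B f g t‖) =ᵐ[μ] fun t => ‖∑' p, ∫ s, P p s t ∂μ‖ :=
    hcong.fun_comp _
  rw [integral_congr_ae hcongn]
  calc ∫ t, ‖∑' p, ∫ s, P p s t ∂μ‖ ∂μ ≤ ∑' p, ∫ t, ‖∫ s, P p s t ∂μ‖ ∂μ := hconv.2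
    _ ≤ ∑' p, ‖B‖ * ∫ t, ∫ s, J p s t ∂μ ∂μ := P_sum.tsum_le_tsum PJ'' (J_sum.mul_left _)
    _ = ‖B‖ * ((∑' n, ∫ s, ‖u n s‖ ∂μ) * ∑' n, ∫ s, ‖v n s‖ ∂μ) := by
        rw [tsum_mul_left, u3.tsum_mul_tsum v3 (u3.mul_of_nonneg v3 hun hvn)]
        simp_rw [J_val]
    _ ≤ ‖B‖ * ((3 * ∫ t, ‖f t‖ ∂μ) * (3 * ∫ t, ‖g t‖ ∂μ)) := by
        gcongr
    _ = 9 * ‖B‖ * (∫ t, ‖f t‖ ∂μ) * ∫ t, ‖g t‖ ∂μ := by ring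

lemma convFun_congr [NormedSpace ℂ E] [μ.IsHaarMeasure] [μ.Regular]
    (B : E →L[ℂ] E →L[ℂ] E) {f f' g g' : G → E} (hf : f =ᵐ[μ] f') (hg : g =ᵐ[μ] g') :
    convFun μ B f g = convFun μ B f' g' := by
  ext t
  refine integral_congr_ae ?_
  filter_upwards [hf, ae_inv_mul hg t] with s h1 h2
  rw [h1, h2]

/-- Convolution as a continuous bilinear multiplication on `L¹(G, E)`, where `E` is a Banach space
with the continuous bilinear multiplication `B`. -/
noncomputable def conv [NormedSpace ℂ E] [CompleteSpace E] (μ : Measure G) [μ.IsHaarMeasure]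
    [μ.Regular] (B : E →L[ℂ] E →L[ℂ] E) : Lp E 1 μ →L[ℂ] Lp E 1 μ →L[ℂ] Lp E 1 μ :=
  LinearMap.mkContinuous₂
    (LinearMap.mk₂ ℂ
      (fun f g => (convFun_aux B (L1.integrable_coeFn f) (L1.integrable_coeFn g)).2.1.toL1 _)
      (by
        intro f₁ f₂ g
        rw [← Integrable.toL1_add, Integrable.toL1_eq_toL1_iff,
          convFun_congr B (Lp.coeFn_add f₁ f₂) (EventuallyEq.refl _ (g : G → E))]
        filter_upwards [(convFun_aux B (L1.integrable_coeFn f₁) (L1.integrable_coeFn g)).1,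
          (convFun_aux B (L1.integrable_coeFn f₂) (L1.integrable_coeFn g)).1] with t h1 h2
        simp [convFun, integral_add h1 h2])
      (by
        intro c f g
        rw [← Integrable.toL1_smul, Integrable.toL1_eq_toL1_iff,
          convFun_congr B (Lp.coeFn_smul c f) (EventuallyEq.refl _ (g : G → E))]
        refine Eventually.of_forall fun t => ?_
        simp [convFun, integral_smul])
      (by
        intro f g₁ g₂
        rw [← Integrable.toL1_add, Integrable.toL1_eq_toL1_iff,
          convFun_congr B (EventuallyEq.refl _ (f : G → E)) (Lp.coeFn_add g₁ g₂)]
        filter_upwards [(convFun_aux B (L1.integrable_coeFn f) (L1.integrable_coeFn g₁)).1,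
          (convFun_aux B (L1.integrable_coeFn f) (L1.integrable_coeFn g₂)).1] with t h1 h2
        simp [convFun, integral_add h1 h2])
      (by
        intro c f g
        rw [← Integrable.toL1_smul, Integrable.toL1_eq_toL1_iff,
          convFun_congr B (EventuallyEq.refl _ (f : G → E)) (Lp.coeFn_smul c g)]
        refine Eventually.of_forall fun t => ?_
        simp [convFun, integral_smul]))
    (9 * ‖B‖)
    (by
      intro f g
      have h := (convFun_aux B (L1.integrable_coeFn f) (L1.integrable_coeFn g)).2
      have e : ‖h.1.toL1 _‖ = ∫ t, ‖convFun μ B f g t‖ ∂μ := by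
        rw [L1.norm_eq_integral_norm]
        exact integral_congr_ae (h.1.coeFn_toL1.fun_comp _)
      rw [L1.norm_eq_integral_norm f, L1.norm_eq_integral_norm g]
      exact e.le.trans h.2)

lemma conv_ae_eq [NormedSpace ℂ E] [CompleteSpace E] [μ.IsHaarMeasure]
    [μ.Regular] (B : E →L[ℂ] E →L[ℂ] E) (f g : Lp E 1 μ) :
    conv μ B f g =ᵐ[μ] fun t => ∫ s, B (f s) (g (s⁻¹ * t)) ∂μ :=
  (convFun_aux B (L1.integrable_coeFn f) (L1.integrable_coeFn g)).2.1.coeFn_toL1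


/-- `f ∈ L^∞(G, X)`: `f` is strongly measurable and essentially bounded, in the sense that is usual
on a locally compact group that need not be `σ`-compact, where null sets are replaced by locally
null sets. On a `σ`-compact group this is the same as being `μ`-strongly measurable and
`μ`-essentially bounded. -/
structure MemLinfty (μ : Measure G) (f : G → E) : Prop where
  aestronglyMeasurable : ∀ K : Set G, IsCompact K → AEStronglyMeasurable f (μ.restrict K)
  bounded : ∃ C : ℝ, ∀ K : Set G, IsCompact K → ∀ᵐ t ∂μ.restrict K, ‖f t‖ ≤ C

lemma MemLinfty.exists_representative [NormedSpace ℂ E] {X : Type*} [NormedAddCommGroup X]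
    [CompleteSpace E] [μ.Regular] {f : G → X} (hf : MemLinfty μ f) {C : ℝ}
    (hC : ∀ K : Set G, IsCompact K → ∀ᵐ t ∂μ.restrict K, ‖f t‖ ≤ C)
    {g : G → E} (hg : Integrable g μ) :
    ∃ f' : G → X, AEStronglyMeasurable f' μ ∧ (∀ᵐ t ∂μ, ‖f' t‖ ≤ max C 0) ∧
      ∀ᵐ t ∂μ, f' t = f t ∨ g t = 0 := by
  obtain ⟨v, v1, v2, -, -, v5⟩ := exists_series hg
  set S : Set G := ⋃ n, tsupport (v n) with hS
  have hSm : MeasurableSet S := MeasurableSet.iUnion fun n => (isClosed_tsupport _).measurableSet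
  have hfS : AEStronglyMeasurable f (μ.restrict S) :=
    aestronglyMeasurable_iUnion_iff.2 fun n => hf.1 _ (v2 n)
  have hCS : ∀ᵐ t ∂μ.restrict S, ‖f t‖ ≤ C :=
    (ae_restrict_iUnion_iff _ _).2 fun n => hC _ (v2 n)
  refine ⟨S.indicator f, (aestronglyMeasurable_indicator_iff hSm).2 hfS, ?_, ?_⟩
  · filter_upwards [(ae_restrict_iff' hSm).1 hCS] with t ht
    by_cases h : t ∈ S
    · simp [h, ht h]
    · simp [h]
  · filter_upwards [v5] with t ht
    by_cases h : t ∈ S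
    · simp [h]
    · right
      have : ∀ n, v n t = 0 := fun n =>
        image_eq_zero_of_notMem_tsupport fun h' => h (Set.mem_iUnion.2 ⟨n, h'⟩)
      have h0 := ht.2
      simp only [this] at h0
      exact h0.unique hasSum_zero

lemma MemLinfty.integrable_pairing [NormedSpace ℂ E] [CompleteSpace E] [μ.Regular]
    {f : G → StrongDual ℂ E} (hf : MemLinfty μ f) {g : G → E} (hg : Integrable g μ) :
    Integrable (fun t => f t (g t)) μ := by
  obtain ⟨C, hC⟩ := hf.2
  obtain ⟨f', h1, h2, h3⟩ := hf.exists_representative hC hg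
  have hi : Integrable (fun t => f' t (g t)) μ := by
    refine (hg.norm.const_mul (max C 0)).mono'
      ((ContinuousLinearMap.id ℂ (StrongDual ℂ E)).aestronglyMeasurable_comp₂ h1 hg.1) ?_
    filter_upwards [h2] with t ht
    exact (f' t).le_of_opNorm_le ht _
  refine hi.congr ?_
  filter_upwards [h3] with t ht
  rcases ht with h | h <;> simp [h]

lemma MemLinfty.norm_integral_pairing_le [NormedSpace ℂ E] [CompleteSpace E] [μ.Regular]
    {f : G → StrongDual ℂ E} (hf : MemLinfty μ f) :
    ∃ C : ℝ, ∀ g : Lp E 1 μ, ‖∫ t, f t (g t) ∂μ‖ ≤ C * ‖g‖ := by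
  obtain ⟨C, hC⟩ := hf.2
  refine ⟨max C 0, fun g => ?_⟩
  have hg := L1.integrable_coeFn g
  obtain ⟨f', h1, h2, h3⟩ := hf.exists_representative hC hg
  rw [L1.norm_eq_integral_norm, ← integral_const_mul]
  refine norm_integral_le_of_norm_le (hg.norm.const_mul _) ?_
  filter_upwards [h2, h3] with t ht1 ht2
  rcases ht2 with h | h
  · rw [← h]
    exact (f' t).le_of_opNorm_le ht1 _
  · simp [h]

/-- The functional `g ↦ ∫ ⟨f(t), g(t)⟩ dμ(t)` on `L¹(G, E)` given by `f ∈ L^∞(G, E*)`. -/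
noncomputable def MemLinfty.functional [NormedSpace ℂ E] [CompleteSpace E] [μ.Regular]
    {f : G → StrongDual ℂ E} (hf : MemLinfty μ f) : StrongDual ℂ (Lp E 1 μ) :=
  LinearMap.mkContinuousOfExistsBound
    { toFun := fun g => ∫ t, f t (g t) ∂μ
      map_add' := fun g h => by
        rw [← integral_add (hf.integrable_pairing (L1.integrable_coeFn g))
          (hf.integrable_pairing (L1.integrable_coeFn h))]
        refine integral_congr_ae ?_
        filter_upwards [Lp.coeFn_add g h] with t ht
        exact (congrArg (f t) ht).trans ((f t).map_add _ _)
      map_smul' := fun c g => by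
        rw [RingHom.id_apply, ← integral_smul]
        refine integral_congr_ae ?_
        filter_upwards [Lp.coeFn_smul c g] with t ht
        exact (congrArg (f t) ht).trans ((f t).map_smul _ _) }
    hf.norm_integral_pairing_le

end Group

section RadonNikodym

universe u v

/-- The Radon-Nikodym property of `X` with respect to the measure space `(S, μ)`: every `X`-valued
measure of bounded variation that is absolutely continuous with respect to `μ` has a density in
`L¹(S, X)`. -/
def HasRNPWith {S : Type u} [MeasurableSpace S] (μ : Measure S) (X : Type v)
    [NormedAddCommGroup X] [NormedSpace ℝ X] : Prop :=
  ∀ F : VectorMeasure S X, F.variation Set.univ < ⊤ →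
    (∀ s, MeasurableSet s → μ s = 0 → F s = 0) →
      ∃ φ : Lp X 1 μ, ∀ s, MeasurableSet s → F s = ∫ t in s, φ t ∂μ

/-- The Radon-Nikodym property of `X`, that is, with respect to every `σ`-finite measure space. -/
def HasRNP (X : Type v) [NormedAddCommGroup X] [NormedSpace ℝ X] : Prop :=
  ∀ (S : Type u) [MeasurableSpace S] (μ : Measure S) [SigmaFinite μ], HasRNPWith μ X

end RadonNikodym

section Arens
variable {E : Type*} [NormedAddCommGroup E] [NormedSpace ℂ E]

/-- The bidual `E**`. -/
abbrev Bidual (E : Type*) [NormedAddCommGroup E] [NormedSpace ℂ E] : Type _ :=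
  StrongDual ℂ (StrongDual ℂ E)

/-! In the following `m a b` is the product `ab` of the algebra `E`. -/

/-- `f_a(b) = f(ab)` -/
noncomputable def rightTr (m : E →L[ℂ] E →L[ℂ] E) (f : StrongDual ℂ E) :
    E →L[ℂ] StrongDual ℂ E :=
  (ContinuousLinearMap.compL ℂ E E ℂ f).comp m

/-- `(_a f)(b) = f(ba)` -/
noncomputable def leftTr (m : E →L[ℂ] E →L[ℂ] E) (f : StrongDual ℂ E) :
    E →L[ℂ] StrongDual ℂ E :=
  (ContinuousLinearMap.compL ℂ E E ℂ f).comp m.flip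

lemma rightTr_apply (m : E →L[ℂ] E →L[ℂ] E) (f : StrongDual ℂ E) (a b : E) :
    rightTr m f a b = f (m a b) := rfl

lemma leftTr_apply (m : E →L[ℂ] E →L[ℂ] E) (f : StrongDual ℂ E) (a b : E) :
    leftTr m f a b = f (m b a) := rfl

lemma norm_rightTr_le (m : E →L[ℂ] E →L[ℂ] E) (f : StrongDual ℂ E) :
    ‖rightTr m f‖ ≤ ‖f‖ * ‖m‖ := by
  refine ContinuousLinearMap.opNorm_le_bound₂ _ (by positivity) fun a b => ?_
  rw [rightTr_apply, mul_assoc, mul_assoc, ← mul_assoc ‖m‖]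
  exact (f.le_opNorm _).trans (by gcongr; exact m.le_opNorm₂ a b)

lemma norm_leftTr_le (m : E →L[ℂ] E →L[ℂ] E) (f : StrongDual ℂ E) :
    ‖leftTr m f‖ ≤ ‖f‖ * ‖m‖ := by
  refine ContinuousLinearMap.opNorm_le_bound₂ _ (by positivity) fun a b => ?_
  rw [leftTr_apply, mul_assoc, mul_assoc, mul_comm ‖a‖, ← mul_assoc ‖m‖]
  exact (f.le_opNorm _).trans (by gcongr; exact m.le_opNorm₂ b a)

/-- The first Arens product `(p □ q)(f) = p(_q f)` of two elements of the bidual of an algebra with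
multiplication `m`, where `(_q f)(a) = q(f_a)`. -/
noncomputable def arensBoxFun (m : E →L[ℂ] E →L[ℂ] E) (p q : Bidual E) : Bidual E :=
  LinearMap.mkContinuous
    { toFun := fun f => p (q.comp (rightTr m f))
      map_add' := fun f g => by
        rw [← map_add]; congr 1; ext a; simp [rightTr]
      map_smul' := fun c f => by
        rw [RingHom.id_apply, ← map_smul]; congr 1; ext a; simp [rightTr] }
    (‖p‖ * ‖q‖ * ‖m‖)
    (fun f => by
      have h1 := p.le_opNorm (q.comp (rightTr m f))
      have h2 := (q.opNorm_comp_le (rightTr m f)).trans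
        (mul_le_mul_of_nonneg_left (norm_rightTr_le m f) (norm_nonneg q))
      refine (h1.trans (mul_le_mul_of_nonneg_left h2 (norm_nonneg p))).trans (le_of_eq ?_)
      ring)

/-- The second Arens product `(p ◇ q)(f) = q(f_p)` of two elements of the bidual of an algebra with
multiplication `m`, where `f_p(a) = p(_a f)`. -/
noncomputable def arensDiamondFun (m : E →L[ℂ] E →L[ℂ] E) (p q : Bidual E) : Bidual E :=
  LinearMap.mkContinuous
    { toFun := fun f => q (p.comp (leftTr m f))
      map_add' := fun f g => by
        rw [← map_add]; congr 1; ext a; simp [leftTr]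
      map_smul' := fun c f => by
        rw [RingHom.id_apply, ← map_smul]; congr 1; ext a; simp [leftTr] }
    (‖p‖ * ‖q‖ * ‖m‖)
    (fun f => by
      have h1 := q.le_opNorm (p.comp (leftTr m f))
      have h2 := (p.opNorm_comp_le (leftTr m f)).trans
        (mul_le_mul_of_nonneg_left (norm_leftTr_le m f) (norm_nonneg p))
      refine (h1.trans (mul_le_mul_of_nonneg_left h2 (norm_nonneg q))).trans (le_of_eq ?_)
      ring)

lemma arensBoxFun_apply (m : E →L[ℂ] E →L[ℂ] E) (p q : Bidual E) (f : StrongDual ℂ E) :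
    arensBoxFun m p q f = p (q.comp (rightTr m f)) := rfl

lemma arensDiamondFun_apply (m : E →L[ℂ] E →L[ℂ] E) (p q : Bidual E) (f : StrongDual ℂ E) :
    arensDiamondFun m p q f = q (p.comp (leftTr m f)) := rfl

lemma norm_arensBoxFun_le (m : E →L[ℂ] E →L[ℂ] E) (p q : Bidual E) :
    ‖arensBoxFun m p q‖ ≤ ‖m‖ * ‖p‖ * ‖q‖ :=
  (LinearMap.mkContinuous_norm_le _ (by positivity) _).trans (le_of_eq (by ring))

lemma norm_arensDiamondFun_le (m : E →L[ℂ] E →L[ℂ] E) (p q : Bidual E) :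
    ‖arensDiamondFun m p q‖ ≤ ‖m‖ * ‖p‖ * ‖q‖ :=
  (LinearMap.mkContinuous_norm_le _ (by positivity) _).trans (le_of_eq (by ring))

/-- The first Arens product as a continuous bilinear multiplication on the bidual. -/
noncomputable def arensBox (m : E →L[ℂ] E →L[ℂ] E) : Bidual E →L[ℂ] Bidual E →L[ℂ] Bidual E :=
  LinearMap.mkContinuous₂
    (LinearMap.mk₂ ℂ (arensBoxFun m)
      (fun p₁ p₂ q => by ext f; simp [arensBoxFun_apply])
      (fun c p q => by ext f; simp [arensBoxFun_apply])
      (fun p q₁ q₂ => by ext f; simp [arensBoxFun_apply, ContinuousLinearMap.add_comp])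
      (fun c p q => by ext f; simp [arensBoxFun_apply, ContinuousLinearMap.smul_comp]))
    ‖m‖ (norm_arensBoxFun_le m)

/-- The second Arens product as a continuous bilinear multiplication on the bidual. -/
noncomputable def arensDiamond (m : E →L[ℂ] E →L[ℂ] E) :
    Bidual E →L[ℂ] Bidual E →L[ℂ] Bidual E :=
  LinearMap.mkContinuous₂
    (LinearMap.mk₂ ℂ (arensDiamondFun m)
      (fun p₁ p₂ q => by ext f; simp [arensDiamondFun_apply, ContinuousLinearMap.add_comp])
      (fun c p q => by ext f; simp [arensDiamondFun_apply, ContinuousLinearMap.smul_comp])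
      (fun p q₁ q₂ => by ext f; simp [arensDiamondFun_apply])
      (fun c p q => by ext f; simp [arensDiamondFun_apply]))
    ‖m‖ (norm_arensDiamondFun_le m)

lemma arensBox_apply (m : E →L[ℂ] E →L[ℂ] E) (p q : Bidual E) (f : StrongDual ℂ E) :
    arensBox m p q f = p (q.comp (rightTr m f)) := rfl

lemma arensDiamond_apply (m : E →L[ℂ] E →L[ℂ] E) (p q : Bidual E) (f : StrongDual ℂ E) :
    arensDiamond m p q f = q (p.comp (leftTr m f)) := rfl

end Arens

/-- `θ : L¹(G, A**) → L¹(G, A)**` is given by `θ(φ)(f) = ∫ ⟨f(t), φ(t)⟩ dμ(t)` for all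
`f ∈ L^∞(G, A*)`, where `f` is regarded as an element of `L¹(G, A)*`. -/
def IsIntegrationMap {G : Type*} [TopologicalSpace G] [Group G] [IsTopologicalGroup G]
    [LocallyCompactSpace G] [T2Space G] [MeasurableSpace G] [BorelSpace G] (μ : Measure G)
    [μ.Regular] {A : Type*} [NormedAddCommGroup A] [NormedSpace ℂ A] [CompleteSpace A]
    (θ : Lp (Bidual A) 1 μ → Bidual (Lp A 1 μ)) : Prop :=
  ∀ (φ : Lp (Bidual A) 1 μ) (f : G → StrongDual ℂ A) (hf : MemLinfty μ f),
    θ φ hf.functional = ∫ t, φ t (f t) ∂μ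

end ArensGroup

open ArensGroup

universe u v

/-! For `u` in L¹(G) and `a` in A write u ⊗ a for the function t ↦ u(t)a, and T_u for the operator a
↦ u ⊗ a. These tensors span a dense subspace of L¹(G, A), and likewise with A** in place of A. If f
∈ L^∞(G, A*) induces the functional F, then F ∘ T_u is the Bochner integral ∫ u f in A*, through
which any m ∈ A** passes. Hence integrating f against u ⊗ m gives m(F ∘ T_u)
(`MemLinfty.bidualFunctional_tmulL1`). This depends on F alone, not on the f representing it, so θ
is well defined and θ(u ⊗ m) = T_u**(m).

Multiplicativity is then algebra. Since (u ⊗ a) * (v ⊗ b) = (u * v) ⊗ ab (`conv_tmulL1`), the two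
sides for the first Arens product, at u ⊗ m, v ⊗ n and F, are both m(a ↦ n(b ↦ F((u * v) ⊗ ab))).
For the second product the order of m and n is reversed. Density and continuity do the rest.

The Radon–Nikodym property serves to represent every F by a function f with ‖f‖ ≤ ‖F‖ locally almost
everywhere (`HasRNP.exists_functional_eq`). On a set of finite measure, s ↦ F(1_s ⊗ ·) is an
A*-valued measure dominated by ‖F‖μ, and f is its density. As G need not be σ-finite, the densities
are glued along a partition of which each compact set meets only countably many pieces.
Representability gives existence and uniqueness of θ, and the bound on f gives ‖θ‖ ≤ 1. The reverse
norm estimate comes from simple functions (`norm_le_of_isIntegrationMap`). -/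

namespace ArensGroup

/-! ### Elementary tensors in L¹ -/

section Tensor
variable {α : Type*} [MeasurableSpace α] {E : Type*} [NormedAddCommGroup E] [NormedSpace ℂ E]

/-- The elementary tensor `u ⊗ a : t ↦ u(t) a` in `L¹(μ, E)`, as a function of `a`. -/
noncomputable def tmulL1 (μ : Measure α) (u : Lp ℂ 1 μ) : E →L[ℂ] Lp E 1 μ :=
  ((ContinuousLinearMap.lsmul ℂ ℂ : ℂ →L[ℂ] E →L[ℂ] E).flip.compLpL₂ 1 μ).flip u

variable {μ : Measure α}

lemma tmulL1_coeFn (u : Lp ℂ 1 μ) (a : E) : tmulL1 μ u a =ᵐ[μ] fun t => u t • a :=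
  ((ContinuousLinearMap.lsmul ℂ ℂ : ℂ →L[ℂ] E →L[ℂ] E).flip a).coeFn_compLp u

lemma tmulL1_indicatorConstLp {s : Set α} (hs : MeasurableSet s) (hμs : μ s ≠ ⊤) (a : E) :
    tmulL1 μ (indicatorConstLp 1 hs hμs 1) a = indicatorConstLp 1 hs hμs a := by
  refine Lp.ext ?_
  filter_upwards [tmulL1_coeFn (indicatorConstLp 1 hs hμs (1 : ℂ)) a,
    indicatorConstLp_coeFn (p := 1) (hs := hs) (hμs := hμs) (c := (1 : ℂ)),
    indicatorConstLp_coeFn (p := 1) (hs := hs) (hμs := hμs) (c := a)] with t h1 h2 h3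
  rw [h1, h2, h3]
  by_cases ht : t ∈ s <;> simp [ht]

/-- Integrable simple functions are sums of tensors 1_s ⊗ a and are dense. This reduces the
linearity, well-definedness and multiplicativity statements below to tensors. -/
lemma ext_tmulL1 {X : Type*} [NormedAddCommGroup X] [NormedSpace ℂ X] {S T : Lp E 1 μ →L[ℂ] X}
    (h : ∀ u a, S (tmulL1 μ u a) = T (tmulL1 μ u a)) : S = T := by
  ext g
  induction g using Lp.induction ENNReal.one_ne_top with
  | indicatorConst c hs hμs =>
    have := h (indicatorConstLp 1 hs hμs.ne 1) c
    rw [tmulL1_indicatorConstLp] at this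
    exact this
  | add hf hg _ h1 h2 => rw [map_add, map_add, h1, h2]
  | isClosed => exact isClosed_eq S.continuous T.continuous

end Tensor

/-! ### Convolution and L^∞ functionals on tensors -/

section Group
variable {G : Type*} [TopologicalSpace G] [Group G] [IsTopologicalGroup G] [LocallyCompactSpace G]
  [T2Space G] [MeasurableSpace G] [BorelSpace G] {μ : Measure G}
  {E : Type*} [NormedAddCommGroup E] [NormedSpace ℂ E] [CompleteSpace E]

lemma conv_tmulL1 [μ.IsHaarMeasure] [μ.Regular] (B : E →L[ℂ] E →L[ℂ] E) (u v : Lp ℂ 1 μ)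
    (a b : E) : conv μ B (tmulL1 μ u a) (tmulL1 μ v b) =
      tmulL1 μ (conv μ (ContinuousLinearMap.mul ℂ ℂ) u v) (B a b) := by
  refine Lp.ext ?_
  filter_upwards [conv_ae_eq B (tmulL1 μ u a) (tmulL1 μ v b),
    tmulL1_coeFn (conv μ (ContinuousLinearMap.mul ℂ ℂ) u v) (B a b),
    conv_ae_eq (ContinuousLinearMap.mul ℂ ℂ) u v] with t h1 h2 h3
  rw [h1, h2, h3, ← integral_smul_const]
  refine integral_congr_ae ?_
  -- The second factor is evaluated at s⁻¹t, so its exceptional null set has to be pulled back along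
  -- s ↦ s⁻¹t.
  filter_upwards [tmulL1_coeFn u a, ae_inv_mul (tmulL1_coeFn v b) t] with s h4 h5
  rw [h4, h5]
  simp [mul_smul, smul_comm (v (s⁻¹ * t))]

/-- Only local measurability of f is available, but f may be replaced by a globally measurable
bounded function that agrees with it almost everywhere where u is nonzero. -/
lemma MemLinfty.integrable_smul [μ.Regular] {f : G → E} (hf : MemLinfty μ f) (u : Lp ℂ 1 μ) :
    Integrable (fun t => u t • f t) μ := by
  obtain ⟨C, hC⟩ := hf.2
  have hu := L1.integrable_coeFn u
  obtain ⟨f', h1, h2, h3⟩ := hf.exists_representative hC hu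
  refine (hu.smul_bdd (max C 0) h1 h2).congr ?_
  filter_upwards [h3] with t ht
  rcases ht with h | h <;> simp [h]

lemma MemLinfty.functional_tmulL1 [μ.Regular] {f : G → StrongDual ℂ E} (hf : MemLinfty μ f)
    (u : Lp ℂ 1 μ) (a : E) : hf.functional (tmulL1 μ u a) = (∫ t, u t • f t ∂μ) a := by
  rw [ContinuousLinearMap.integral_apply (hf.integrable_smul u)]
  refine integral_congr_ae ?_
  filter_upwards [tmulL1_coeFn u a] with t ht
  exact (congrArg (f t) ht).trans ((f t).map_smul _ _)

/-- The sharp constant matters: both halves of the isometry rest on it. -/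
lemma MemLinfty.norm_functional_le [μ.Regular] {f : G → StrongDual ℂ E} (hf : MemLinfty μ f)
    {C : ℝ} (hC0 : 0 ≤ C) (hC : ∀ K : Set G, IsCompact K → ∀ᵐ t ∂μ.restrict K, ‖f t‖ ≤ C) :
    ‖hf.functional‖ ≤ C := by
  refine ContinuousLinearMap.opNorm_le_bound _ hC0 fun g => ?_
  have hg := L1.integrable_coeFn g
  obtain ⟨f', h1, h2, h3⟩ := hf.exists_representative hC hg
  rw [L1.norm_eq_integral_norm, ← integral_const_mul]
  refine norm_integral_le_of_norm_le (hg.norm.const_mul _) ?_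
  filter_upwards [h2, h3] with t ht1 ht2
  rcases ht2 with h | h
  · rw [← h]
    exact (f' t).le_of_opNorm_le (by rwa [max_eq_left hC0] at ht1) _
  · simp [h]

/-- Applied to dual-valued f, this makes the pairing with E**-valued functions a case of
`MemLinfty.functional`. -/
lemma MemLinfty.inclusionInDoubleDual {f : G → E} (hf : MemLinfty μ f) :
    MemLinfty μ fun t => NormedSpace.inclusionInDoubleDual ℂ E (f t) where
  aestronglyMeasurable K hK :=
    (NormedSpace.inclusionInDoubleDual ℂ E).continuous.comp_aestronglyMeasurable (hf.1 K hK)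
  bounded := by
    obtain ⟨C, hC⟩ := hf.2
    refine ⟨C, fun K hK => (hC K hK).mono fun t ht => ?_⟩
    exact ((NormedSpace.inclusionInDoubleDualLi ℂ (E := E)).norm_map (f t)).le.trans ht

/-- The functional `φ ↦ ∫ ⟨f(t), φ(t)⟩ dμ(t)` on `L¹(G, E**)` given by `f ∈ L^∞(G, E*)`. -/
noncomputable def MemLinfty.bidualFunctional [μ.Regular] {f : G → StrongDual ℂ E}
    (hf : MemLinfty μ f) : StrongDual ℂ (Lp (Bidual E) 1 μ) :=
  hf.inclusionInDoubleDual.functional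

/-- A continuous functional m commutes with the Bochner integral ∫ u f in E*. The point is that the
result involves f only through the functional it induces. -/
lemma MemLinfty.bidualFunctional_tmulL1 [μ.Regular] {f : G → StrongDual ℂ E}
    (hf : MemLinfty μ f) (u : Lp ℂ 1 μ) (m : Bidual E) :
    hf.bidualFunctional (tmulL1 μ u m) = m (hf.functional.comp (tmulL1 μ u)) := by
  have h : hf.functional.comp (tmulL1 μ u) = ∫ t, u t • f t ∂μ := by
    ext a
    exact hf.functional_tmulL1 u a
  rw [h, ← ContinuousLinearMap.integral_comp_comm m (hf.integrable_smul u)]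
  refine integral_congr_ae ?_
  filter_upwards [tmulL1_coeFn u m] with t ht
  rw [ht]
  simp

end Group

/-! ### Radon–Nikodym densities on sets of finite measure -/

section Density
variable {S : Type u} [MeasurableSpace S] {E : Type v} [NormedAddCommGroup E] [NormedSpace ℂ E]

/-- This domination by ‖F‖μ yields countable additivity, bounded variation and absolute continuity
of the associated measure, and later the bound on its density. -/
lemma norm_comp_tmulL1_indicator_le {μ : Measure S} (F : StrongDual ℂ (Lp E 1 μ)) {s : Set S}
    (hs : MeasurableSet s) (hμs : μ s ≠ ⊤) :
    ‖F.comp (tmulL1 μ (indicatorConstLp 1 hs hμs 1))‖ ≤ ‖F‖ * μ.real s := by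
  refine ContinuousLinearMap.opNorm_le_bound _ (by positivity) fun a => ?_
  rw [ContinuousLinearMap.comp_apply, tmulL1_indicatorConstLp, mul_assoc]
  refine (F.le_opNorm _).trans ?_
  gcongr
  refine norm_indicatorConstLp_le.trans (le_of_eq ?_)
  simp [mul_comm]

/-- The vector measure `s ↦ (a ↦ F(1_{s ∩ P} a))` given by a functional `F` on `L¹(μ, E)` and a set
`P` of finite measure. -/
lemma exists_vectorMeasure {μ : Measure S} (F : StrongDual ℂ (Lp E 1 μ)) {P : Set S}
    (hP : MeasurableSet P) (hμP : μ P ≠ ⊤) :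
    ∃ m : VectorMeasure S (StrongDual ℂ E),
      (∀ (s : Set S) (hs : MeasurableSet s) (hμs : μ s ≠ ⊤), s ⊆ P →
        m s = F.comp (tmulL1 μ (indicatorConstLp 1 hs hμs 1))) ∧
      ∀ s, ‖m s‖ₑ ≤ (ENNReal.ofReal ‖F‖ • μ.restrict P) s := by
  classical
  have hfin' : IsFiniteMeasure (μ.restrict P) := isFiniteMeasure_restrict.2 hμP
  have hfin : IsFiniteMeasure (ENNReal.ofReal ‖F‖ • μ.restrict P) :=
    (μ.restrict P).smul_finite ENNReal.ofReal_ne_top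
  have hμ (s : Set S) : μ (s ∩ P) ≠ ⊤ := measure_ne_top_of_subset Set.inter_subset_right hμP
  -- Intersecting with P keeps all indicators in L¹; the value 0 on non-measurable sets is the
  -- convention of `VectorMeasure`.
  set m : Set S → StrongDual ℂ E := fun s =>
    if hs : MeasurableSet s then F.comp (tmulL1 μ (indicatorConstLp 1 (hs.inter hP) (hμ s) 1))
    else 0 with hm
  have hle : ∀ s, ‖m s‖ₑ ≤ (ENNReal.ofReal ‖F‖ • μ.restrict P) s := by
    intro s
    by_cases hs : MeasurableSet s
    · simp only [hm, hs, dite_true]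
      rw [← ofReal_norm]
      refine (ENNReal.ofReal_le_ofReal
        (norm_comp_tmulL1_indicator_le F (hs.inter hP) (hμ s))).trans (le_of_eq ?_)
      rw [ENNReal.ofReal_mul (norm_nonneg _), ofReal_measureReal (hμ s),
        ← Measure.restrict_apply hs]
      rfl
    · simp [hm, hs]
  -- Finite additivity suffices, since domination by a finite measure upgrades it to countable
  -- additivity.
  refine ⟨VectorMeasure.of_additive_of_le_measure m hle (fun s t hs ht hst => ?_)
    fun s hs => by simp [hm, hs], fun s hs hμs hsP => ?_, hle⟩
  · simp only [hm, hs, ht, hs.union ht, dite_true]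
    ext a
    simp only [add_apply, ContinuousLinearMap.comp_apply, tmulL1_indicatorConstLp]
    rw [← map_add, ← indicatorConstLp_disjoint_union (hs.inter hP) (ht.inter hP) (hμ s) (hμ t)
      (hst.mono Set.inter_subset_left Set.inter_subset_left)]
    simp only [Set.union_inter_distrib_right]
  · change m s = _
    simp only [hm, hs, dite_true, Set.inter_eq_left.2 hsP]

/-- A bound on the vector measure φμ set by set bounds its variation, and the variation is ‖φ‖μ. So
the integrals of ‖φ‖ over all measurable sets are at most those of C. -/
lemma ae_norm_le_of_enorm_setIntegral_le {μ : Measure S} [IsFiniteMeasure μ] {X : Type*}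
    [NormedAddCommGroup X] [NormedSpace ℝ X] [CompleteSpace X] {φ : S → X} (hφ : Integrable φ μ)
    {C : ℝ} (hC : 0 ≤ C)
    (h : ∀ s, MeasurableSet s → ‖∫ t in s, φ t ∂μ‖ₑ ≤ (ENNReal.ofReal C • μ) s) :
    ∀ᵐ t ∂μ, ‖φ t‖ ≤ C := by
  refine ae_le_of_forall_setIntegral_le hφ.norm (integrable_const C) fun s hs _ => ?_
  have h1 : (μ.withDensityᵥ φ).variation ≤ ENNReal.ofReal C • μ :=
    VectorMeasure.variation_le_of_forall_enorm_le fun s hs => by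
      rw [withDensityᵥ_apply hφ hs]
      exact h s hs
  rw [Measure.variation_withDensityᵥ hφ] at h1
  have h2 := h1 s
  rw [withDensity_apply _ hs] at h2
  have h3 := ofReal_integral_norm_eq_lintegral_enorm hφ.integrableOn (μ := μ.restrict s)
  rw [← h3] at h2
  have h4 : (ENNReal.ofReal C • μ) s = ENNReal.ofReal (C * μ.real s) := by
    rw [ENNReal.ofReal_mul hC, ofReal_measureReal]
    rfl
  rw [h4, ENNReal.ofReal_le_ofReal_iff (by positivity)] at h2
  simpa [mul_comm] using h2

/-- If `E*` has the Radon-Nikodym property, then every functional on `L¹(μ, E)` is given by a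
density on every set of finite measure. -/
lemma HasRNP.exists_density (h : HasRNP.{u, v} (StrongDual ℂ E)) {μ : Measure S}
    (F : StrongDual ℂ (Lp E 1 μ)) {P : Set S} (hP : MeasurableSet P) (hμP : μ P ≠ ⊤) :
    ∃ φ : S → StrongDual ℂ E, StronglyMeasurable φ ∧ IntegrableOn φ P μ ∧
      (∀ᵐ t ∂μ.restrict P, ‖φ t‖ ≤ ‖F‖) ∧
      ∀ (s : Set S) (hs : MeasurableSet s) (hμs : μ s ≠ ⊤) (a : E), s ⊆ P →
        F (indicatorConstLp 1 hs hμs a) = (∫ t in s, φ t ∂μ) a := by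
  have hfin : IsFiniteMeasure (μ.restrict P) := isFiniteMeasure_restrict.2 hμP
  obtain ⟨m, hm, hle⟩ := exists_vectorMeasure F hP hμP
  have hvar := VectorMeasure.variation_le_of_forall_enorm_le (μ := m) fun s _ => hle s
  obtain ⟨φ, hφ⟩ := h S (μ.restrict P) m (lt_of_le_of_lt (hvar _)
      (ENNReal.mul_lt_top ENNReal.ofReal_lt_top (measure_lt_top _ _))) fun s _ h0 => by
    have := hle s
    simpa [h0] using this
  refine ⟨φ, Lp.stronglyMeasurable φ, L1.integrable_coeFn φ, ?_, fun s hs hμs a hsP => ?_⟩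
  · refine ae_norm_le_of_enorm_setIntegral_le (L1.integrable_coeFn φ) (norm_nonneg F)
      fun s hs => ?_
    rw [← hφ s hs]
    exact hle s
  · have h1 := hφ s hs
    rw [Measure.restrict_restrict hs, Set.inter_eq_left.2 hsP] at h1
    rw [← h1, hm s hs hμs hsP, ContinuousLinearMap.comp_apply, tmulL1_indicatorConstLp]

lemma ae_eq_of_setIntegral_eq {X : Type*} [NormedAddCommGroup X] [NormedSpace ℝ X]
    [CompleteSpace X] {μ : Measure S} {P : Set S} {φ ψ : S → X} (hP : MeasurableSet P)
    (hφ : IntegrableOn φ P μ) (hψ : IntegrableOn ψ P μ)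
    (h : ∀ s, MeasurableSet s → s ⊆ P → ∫ t in s, φ t ∂μ = ∫ t in s, ψ t ∂μ) :
    φ =ᵐ[μ.restrict P] ψ := by
  refine Integrable.ae_eq_of_forall_setIntegral_eq φ ψ hφ hψ fun s hs _ => ?_
  rw [Measure.restrict_restrict hs]
  exact h _ (hs.inter hP) Set.inter_subset_right

end Density

/-! ### Locally countable partitions of a locally compact group -/

section Partition
variable {G : Type u} [TopologicalSpace G] [Group G] [IsTopologicalGroup G] [LocallyCompactSpace G]

open scoped Pointwise in
/-- A locally compact group has an open `σ`-compact subgroup. -/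
lemma exists_openSubgroup_sigmaCompact (G : Type u) [TopologicalSpace G] [Group G]
    [IsTopologicalGroup G] [LocallyCompactSpace G] :
    ∃ (H : Subgroup G) (W : ℕ → Set G), IsOpen (H : Set G) ∧ (∀ n, IsCompact (W n)) ∧
      (H : Set G) ⊆ ⋃ n, W n := by
  obtain ⟨V, hV, hV1⟩ := exists_compact_mem_nhds (1 : G)
  -- The subgroup generated by a compact neighbourhood V of 1 is open and is exhausted by words of
  -- length n in V ∪ V⁻¹.
  refine ⟨Subgroup.closure V, fun n => (V ∪ V⁻¹) ^ n,
    Subgroup.isOpen_of_mem_nhds _ (mem_of_superset hV1 Subgroup.subset_closure), fun n => ?_,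
    fun x hx => ?_⟩
  · induction n with
    | zero => simp
    | succ n ih => simpa [pow_succ] using ih.mul (hV.union hV.inv)
  · induction hx using Subgroup.closure_induction'' with
    | one => exact Set.mem_iUnion.2 ⟨0, by simp⟩
    | mem x hx => exact Set.mem_iUnion.2 ⟨1, by simp [hx]⟩
    | inv_mem x hx => exact Set.mem_iUnion.2 ⟨1, by simp [hx]⟩
    | mul x y _ _ h1 h2 =>
      obtain ⟨n, hn⟩ := Set.mem_iUnion.1 h1
      obtain ⟨k, hk⟩ := Set.mem_iUnion.1 h2
      exact Set.mem_iUnion.2 ⟨n + k, by simpa [pow_add] using Set.mul_mem_mul hn hk⟩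

/-- A locally compact group has a partition into measurable sets of finite Haar measure of which
every compact set meets only countably many. -/
lemma exists_locallyCountable_partition [T2Space G] [MeasurableSpace G] [BorelSpace G]
    (μ : Measure G) [IsFiniteMeasureOnCompacts μ] :
    ∃ (ι : Type u) (i : G → ι), (∀ j, MeasurableSet (i ⁻¹' {j})) ∧ (∀ j, μ (i ⁻¹' {j}) ≠ ⊤) ∧
      ∀ K : Set G, IsCompact K → (i '' K).Countable := by
  classical
  obtain ⟨H, W, hH, hW, hHW⟩ := exists_openSubgroup_sigmaCompact G
  have hd : DiscreteTopology (G ⧸ H) := QuotientGroup.discreteTopology hH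
  -- A piece is labelled by a coset of H and by the first k for which the translate of t back into H
  -- lies in W k.
  set r : G → G := fun t => (QuotientGroup.mk t : G ⧸ H).out⁻¹ * t with hr
  have hrH : ∀ t, r t ∈ H := fun t => QuotientGroup.eq.1 (Quotient.out_eq _)
  -- The first alternative only makes the index total: it is 0 off H.
  have hp : ∀ t, ∃ k, t ∉ H ∨ t ∈ W k := fun t => by
    by_cases ht : t ∈ H
    · obtain ⟨k, hk⟩ := Set.mem_iUnion.1 (hHW ht)
      exact ⟨k, Or.inr hk⟩
    · exact ⟨0, Or.inl ht⟩
  set n : G → ℕ := fun t => Nat.find (hp t) with hn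
  have hnH : ∀ t ∈ H, t ∈ W (n t) := fun t ht => (Nat.find_spec (hp t)).resolve_left (not_not.2 ht)
  have hnm : Measurable n := measurable_find hp fun k =>
    hH.measurableSet.compl.union (hW k).measurableSet
  have hfib : ∀ j : (G ⧸ H) × ℕ, (fun t => ((QuotientGroup.mk t : G ⧸ H), n (r t))) ⁻¹' {j} =
      (QuotientGroup.mk ⁻¹' {j.1}) ∩ {t | n (j.1.out⁻¹ * t) = j.2} := by
    rintro ⟨q, k⟩
    ext t
    simp only [hr, Set.mem_preimage, Set.mem_singleton_iff, Prod.mk.injEq, Set.mem_inter_iff,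
      Set.mem_ofPred_eq]
    exact and_congr_right fun h => by rw [h]
  refine ⟨(G ⧸ H) × ℕ, fun t => (QuotientGroup.mk t, n (r t)), fun j => ?_, fun j => ?_,
    fun K hK => ?_⟩
  · rw [hfib]
    refine ((isOpen_discrete {j.1}).preimage QuotientGroup.continuous_mk).measurableSet.inter ?_
    exact (hnm.comp (measurable_const_mul _)) (measurableSet_singleton j.2)
  · rw [hfib]
    refine measure_ne_top_of_subset (μ := μ) (s := (fun t => j.1.out * t) '' W j.2) ?_
      ((hW j.2).image (continuous_const_mul _)).measure_lt_top.ne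
    rintro t ⟨h1, h2⟩
    refine ⟨j.1.out⁻¹ * t, ?_, by simp⟩
    have h3 := hrH t
    simp only [Set.mem_preimage, Set.mem_singleton_iff] at h1
    simp only [hr, h1] at h3
    have h4 := hnH _ h3
    rwa [h2] at h4
  -- H is open, so the quotient is discrete and K meets finitely many cosets, each cut into
  -- countably many pieces.
  · have h1 : ((QuotientGroup.mk : G → G ⧸ H) '' K).Finite :=
      (hK.image QuotientGroup.continuous_mk).finite_of_discrete
    refine (h1.countable.prod (Set.countable_univ (α := ℕ))).mono ?_
    rintro _ ⟨t, ht, rfl⟩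
    exact ⟨⟨t, ht, rfl⟩, trivial⟩

end Partition

/-! ### Representing functionals by L^∞ functions -/

section Representation
variable {G : Type u} [TopologicalSpace G] [Group G] [IsTopologicalGroup G] [LocallyCompactSpace G]
  [T2Space G] [MeasurableSpace G] [BorelSpace G] {μ : Measure G}
  {E : Type v} [NormedAddCommGroup E] [NormedSpace ℂ E] [CompleteSpace E]

/-- Almost everywhere g is the sum of a series of compactly supported functions; their supports are
the compact sets. -/
lemma exists_isCompact_iUnion_ae_eq_zero [μ.Regular] {g : G → E} (hg : Integrable g μ) :
    ∃ K : ℕ → Set G, (∀ n, IsCompact (K n)) ∧ ∀ᵐ t ∂μ, t ∈ ⋃ n, K n ∨ g t = 0 := by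
  obtain ⟨v, -, v2, -, -, v5⟩ := exists_series hg
  refine ⟨fun n => tsupport (v n), v2, ?_⟩
  filter_upwards [v5] with t ht
  by_cases h : t ∈ ⋃ n, tsupport (v n)
  · exact Or.inl h
  · have h0 := ht.2
    have : ∀ n, v n t = 0 := fun n =>
      image_eq_zero_of_notMem_tsupport fun h' => h (Set.mem_iUnion.2 ⟨n, h'⟩)
    simp only [this] at h0
    exact Or.inr (h0.unique hasSum_zero)

/-- If `E*` has the Radon-Nikodym property, then every functional on `L¹(G, E)` is given by an
element of `L^∞(G, E*)` that is bounded by its norm. -/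
lemma HasRNP.exists_functional_eq [μ.IsHaarMeasure] [μ.Regular]
    (h : HasRNP.{u, v} (StrongDual ℂ E)) (F : StrongDual ℂ (Lp E 1 μ)) :
    ∃ (f : G → StrongDual ℂ E) (hf : MemLinfty μ f), F = hf.functional ∧
      ∀ K : Set G, IsCompact K → ∀ᵐ t ∂μ.restrict K, ‖f t‖ ≤ ‖F‖ := by
  obtain ⟨ι, i, hi, hμi, hK⟩ := exists_locallyCountable_partition μ
  choose φ hφm hφi hφb hφ using fun j => h.exists_density F (hi j) (hμi j)
  -- There may be uncountably many pieces, so almost-everywhere statements can be combined only over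
  -- sets meeting countably many of them; compact sets do.
  set f : G → StrongDual ℂ E := fun t => φ (i t) t with hf_def
  have hfφ : ∀ j, f =ᵐ[μ.restrict (i ⁻¹' {j})] φ j := fun j => by
    filter_upwards [ae_restrict_mem (hi j)] with t ht
    have : i t = j := ht
    simp only [hf_def, this]
  have hcov : ∀ s : Set G, s ⊆ ⋃ j : i '' s, i ⁻¹' {(j : ι)} := fun s t ht =>
    Set.mem_iUnion.2 ⟨⟨i t, t, ht, rfl⟩, rfl⟩
  have hb : ∀ K : Set G, IsCompact K → ∀ᵐ t ∂μ.restrict K, ‖f t‖ ≤ ‖F‖ := fun K hKc => by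
    have := (hK K hKc).to_subtype
    refine ae_restrict_of_ae_restrict_of_subset (hcov K) ((ae_restrict_iUnion_iff _ _).2 fun j => ?_)
    filter_upwards [hφb j, hfφ j] with t h1 h2
    rwa [h2]
  have hf : MemLinfty μ f := by
    refine ⟨fun K hKc => ?_, ‖F‖, hb⟩
    have := (hK K hKc).to_subtype
    refine AEStronglyMeasurable.mono_set (hcov K) (aestronglyMeasurable_iUnion_iff.2 fun j => ?_)
    exact (hφm j).aestronglyMeasurable.congr (hfφ j).symm
  refine ⟨f, hf, ?_, hb⟩
  have key : ∀ (s : Set G) (hs : MeasurableSet s) (hμs : μ s ≠ ⊤) (a : E),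
      F (indicatorConstLp 1 hs hμs a) = hf.functional (indicatorConstLp 1 hs hμs a) := by
    intro s hs hμs a
    -- A set s of finite measure may meet uncountably many pieces, so F on s is first computed with
    -- a density ψ on s itself. Then ψ = f almost everywhere on s, because s is covered up to a null
    -- set by countably many compact sets and densities on each s ∩ i⁻¹{j} are unique.
    obtain ⟨ψ, -, hψi, -, hψ⟩ := h.exists_density F hs hμs
    have hint : IntegrableOn (fun _ : G => (1 : ℂ)) s μ := integrableOn_const hμs
    obtain ⟨K, hKc, hKs⟩ := exists_isCompact_iUnion_ae_eq_zero (hint.integrable_indicator hs)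
    have hloc : ∀ j, ψ =ᵐ[μ.restrict (s ∩ i ⁻¹' {j})] f := fun j => by
      have h1 : ψ =ᵐ[μ.restrict (s ∩ i ⁻¹' {j})] φ j := by
        refine ae_eq_of_setIntegral_eq (hs.inter (hi j)) (hψi.mono_set Set.inter_subset_left)
          ((hφi j).mono_set Set.inter_subset_right) fun r hr hrs => ?_
        have hμr : μ r ≠ ⊤ := measure_ne_top_of_subset (hrs.trans Set.inter_subset_left) hμs
        ext b
        rw [← hψ r hr hμr b (hrs.trans Set.inter_subset_left),
          ← hφ j r hr hμr b (hrs.trans Set.inter_subset_right)]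
      have h2 : f =ᵐ[μ.restrict (s ∩ i ⁻¹' {j})] φ j :=
        ae_restrict_of_ae_restrict_of_subset Set.inter_subset_right (hfφ j)
      exact h1.trans h2.symm
    have hψf : ψ =ᵐ[μ.restrict s] f := by
      have h1 : ∀ n, ∀ᵐ t ∂μ.restrict (s ∩ K n), ψ t = f t := fun n => by
        have := (hK (K n) (hKc n)).to_subtype
        refine ae_restrict_of_ae_restrict_of_subset (t := ⋃ j : i '' K n, s ∩ i ⁻¹' {(j : ι)}) ?_
          ((ae_restrict_iUnion_iff _ _).2 fun j => hloc j)
        rw [← Set.inter_iUnion]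
        exact Set.inter_subset_inter_right s (hcov (K n))
      have h2 := (ae_restrict_iUnion_iff (μ := μ) (fun n => s ∩ K n) _).2 h1
      rw [← Set.inter_iUnion, ae_restrict_iff' (hs.inter
        (MeasurableSet.iUnion fun n => (hKc n).measurableSet))] at h2
      refine (ae_restrict_iff' hs).2 ?_
      filter_upwards [h2, hKs] with t h3 h4 hts
      rcases h4 with h4 | h4
      · exact h3 ⟨hts, h4⟩
      · simp [hts] at h4
    rw [hψ s hs hμs a subset_rfl, ← tmulL1_indicatorConstLp, hf.functional_tmulL1,
      integral_congr_ae hψf, ← integral_indicator hs]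
    congr 1
    refine integral_congr_ae ?_
    filter_upwards [indicatorConstLp_coeFn (p := 1) (hs := hs) (hμs := hμs) (c := (1 : ℂ))]
      with t ht
    rw [ht]
    by_cases hts : t ∈ s <;> simp [hts]
  ext g
  induction g using Lp.induction ENNReal.one_ne_top with
  | indicatorConst c hs hμs => exact key _ hs hμs.ne c
  | add hf hg _ h1 h2 => rw [map_add, map_add, h1, h2]
  | isClosed => exact isClosed_eq F.continuous (ContinuousLinearMap.continuous _)

end Representation

/-! ### The integration map: existence, isometry, multiplicativity -/

section IntegrationMap
variable {G : Type u} [TopologicalSpace G] [Group G] [IsTopologicalGroup G] [LocallyCompactSpace G]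
  [T2Space G] [MeasurableSpace G] [BorelSpace G] {μ : Measure G}
  {E : Type v} [NormedAddCommGroup E] [NormedSpace ℂ E] [CompleteSpace E]

lemma MemLinfty.norm_bidualFunctional_le [μ.Regular] {f : G → StrongDual ℂ E}
    (hf : MemLinfty μ f) {C : ℝ} (hC0 : 0 ≤ C)
    (hC : ∀ K : Set G, IsCompact K → ∀ᵐ t ∂μ.restrict K, ‖f t‖ ≤ C) :
    ‖hf.bidualFunctional‖ ≤ C :=
  hf.inclusionInDoubleDual.norm_functional_le hC0 fun K hK => (hC K hK).mono fun t ht =>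
    ((NormedSpace.inclusionInDoubleDualLi ℂ (E := StrongDual ℂ E)).norm_map (f t)).le.trans ht

/-- A functional of norm at most one on which `m` almost attains its norm. -/
lemma exists_norming (m : Bidual E) {c : ℝ} (hc : c < 1) :
    ∃ x : StrongDual ℂ E, ‖x‖ ≤ 1 ∧ c * ‖m‖ ≤ (m x).re := by
  rcases eq_or_ne m 0 with rfl | hm
  · exact ⟨0, by simp, by simp⟩
  obtain ⟨x, hx, hxm⟩ := m.exists_lt_apply_of_lt_opNorm
    (mul_lt_of_lt_one_left (norm_pos_iff.2 hm) hc)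
  obtain ⟨w, hw, hwx⟩ := RCLike.exists_norm_eq_mul_self (m x)
  refine ⟨w • x, ?_, ?_⟩
  · rw [norm_smul, hw, one_mul]
    exact hx.le
  · rw [map_smul, smul_eq_mul, ← hwx]
    exact hxm.le

lemma memLinfty_simpleFunc {X : Type*} [NormedAddCommGroup X] (f : SimpleFunc G X) {C : ℝ}
    (hC : ∀ t, ‖f t‖ ≤ C) : MemLinfty μ f :=
  ⟨fun _ _ => f.stronglyMeasurable.aestronglyMeasurable, C, fun _ _ => Eventually.of_forall hC⟩

/-- The norm of `L¹(G, E**)` is determined by pairing with `L^∞(G, E*)`. -/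
lemma norm_le_of_isIntegrationMap [μ.Regular]
    {θ : Lp (Bidual E) 1 μ →L[ℂ] Bidual (Lp E 1 μ)} (hθ : IsIntegrationMap μ θ)
    (φ : Lp (Bidual E) 1 μ) : ‖φ‖ ≤ ‖θ φ‖ := by
  refine (Lp.simpleFunc.denseRange (E := Bidual E) (μ := μ) ENNReal.one_ne_top).induction_on φ
    (isClosed_le continuous_norm θ.continuous.norm) fun s => ?_
  have hs : Integrable (Lp.simpleFunc.toSimpleFunc s) μ :=
    memLp_one_iff_integrable.1 (Lp.simpleFunc.memLp s)
  have hcoe := Lp.simpleFunc.toSimpleFunc_eq_toFun s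
  -- Elements of E** need not attain their norm on the unit ball of E*, so the estimate is proved
  -- with a factor c < 1 and then c → 1.
  have hlim : Tendsto (fun c : ℝ => c * ‖(s : Lp (Bidual E) 1 μ)‖) (𝓝[<] 1)
      (𝓝 (1 * ‖(s : Lp (Bidual E) 1 μ)‖)) :=
    tendsto_nhdsWithin_of_tendsto_nhds ((continuous_mul_const _).tendsto 1)
  rw [one_mul] at hlim
  refine le_of_tendsto hlim (eventually_mem_nhdsWithin.mono fun c hc => ?_)
  -- An arbitrary choice of norming functionals is harmless: composed with a simple function it is
  -- again simple, so no measurable selection is needed.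
  choose χ hχ1 hχ using fun m : Bidual E => exists_norming m hc
  set f := (Lp.simpleFunc.toSimpleFunc s).map χ with hf_def
  have hf1 : ∀ t, ‖f t‖ ≤ 1 := fun t => hχ1 _
  have hf : MemLinfty μ f := memLinfty_simpleFunc f hf1
  have hF : ‖hf.functional‖ ≤ 1 :=
    hf.norm_functional_le zero_le_one fun K _ => Eventually.of_forall hf1
  have hval : θ s hf.functional =
      ∫ t, Lp.simpleFunc.toSimpleFunc s t (χ (Lp.simpleFunc.toSimpleFunc s t)) ∂μ := by
    rw [hθ]
    refine integral_congr_ae ?_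
    filter_upwards [hcoe] with t ht
    rw [← ht]
    rfl
  have hint : Integrable
      (fun t => Lp.simpleFunc.toSimpleFunc s t (χ (Lp.simpleFunc.toSimpleFunc s t))) μ := by
    have := hf.inclusionInDoubleDual.integrable_pairing hs
    exact this
  have hnorm : ‖(s : Lp (Bidual E) 1 μ)‖ = ∫ t, ‖Lp.simpleFunc.toSimpleFunc s t‖ ∂μ := by
    rw [L1.norm_eq_integral_norm]
    refine integral_congr_ae ?_
    filter_upwards [hcoe] with t ht
    rw [← ht]
  calc c * ‖(s : Lp (Bidual E) 1 μ)‖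
      = ∫ t, c * ‖Lp.simpleFunc.toSimpleFunc s t‖ ∂μ := by rw [hnorm, integral_const_mul]
    _ ≤ ∫ t, (Lp.simpleFunc.toSimpleFunc s t (χ (Lp.simpleFunc.toSimpleFunc s t))).re ∂μ :=
        integral_mono (hs.norm.const_mul c) hint.re fun t => hχ _
    _ = (θ s hf.functional).re := by
        rw [hval]
        exact integral_re hint
    _ ≤ ‖θ s hf.functional‖ := Complex.re_le_norm _
    _ ≤ ‖θ s‖ * ‖hf.functional‖ := (θ s).le_opNorm _
    _ ≤ ‖θ s‖ := mul_le_of_le_one_right (norm_nonneg _) hF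

/-- If `E*` has the Radon-Nikodym property, the integration map exists, and on elementary tensors
`u ⊗ m` it is the second adjoint of `a ↦ u ⊗ a`. -/
lemma HasRNP.exists_integrationMap [μ.IsHaarMeasure] [μ.Regular]
    (h : HasRNP.{u, v} (StrongDual ℂ E)) :
    ∃ θ : Lp (Bidual E) 1 μ →ₗᵢ[ℂ] Bidual (Lp E 1 μ), IsIntegrationMap μ θ ∧
      ∀ (u : Lp ℂ 1 μ) (m : Bidual E) (F : StrongDual ℂ (Lp E 1 μ)),
        θ (tmulL1 μ u m) F = m (F.comp (tmulL1 μ u)) := by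
  -- The choice of f need not be linear in F. By `htm` the functional on L¹(G, E**) that it induces
  -- takes values on tensors that are linear in F, hence is itself linear in F.
  choose f hf hF hb using fun F : StrongDual ℂ (Lp E 1 μ) => h.exists_functional_eq F
  have htm : ∀ F u m, (hf F).bidualFunctional (tmulL1 μ u m) = m (F.comp (tmulL1 μ u)) :=
    fun F u m => by rw [(hf F).bidualFunctional_tmulL1, ← hF F]
  set Θ : StrongDual ℂ (Lp E 1 μ) →L[ℂ] StrongDual ℂ (Lp (Bidual E) 1 μ) :=
    LinearMap.mkContinuous
      { toFun := fun F => (hf F).bidualFunctional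
        map_add' := fun F F' => ext_tmulL1 fun u m => by
          rw [add_apply, htm, htm, htm, ← map_add, ContinuousLinearMap.add_comp]
        map_smul' := fun c F => ext_tmulL1 fun u m => by
          rw [RingHom.id_apply, smul_apply, htm, htm, ← map_smul,
            ContinuousLinearMap.smul_comp] }
      1 (fun F => (one_mul ‖F‖).symm ▸
        (hf F).norm_bidualFunctional_le (norm_nonneg F) (hb F)) with hΘ
  have hΘ1 : ‖Θ‖ ≤ 1 := LinearMap.mkContinuous_norm_le _ zero_le_one _
  have hint : IsIntegrationMap μ Θ.flip := by
    intro φ g hg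
    -- Here g is any representative, not the chosen one; both give the same value on tensors.
    have : Θ hg.functional = hg.bidualFunctional := ext_tmulL1 fun u m => by
      rw [hg.bidualFunctional_tmulL1]
      exact htm _ u m
    rw [ContinuousLinearMap.flip_apply, this]
    rfl
  refine ⟨⟨Θ.flip.toLinearMap, fun φ => le_antisymm ?_ (norm_le_of_isIntegrationMap hint φ)⟩,
    hint, fun u m F => htm F u m⟩
  refine (Θ.flip.le_opNorm φ).trans ?_
  rw [ContinuousLinearMap.opNorm_flip]
  exact mul_le_of_le_one_left (norm_nonneg φ) hΘ1

lemma bilinear_ext_tmulL1 {X Y : Type*} [NormedAddCommGroup X] [NormedSpace ℂ X]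
    [NormedAddCommGroup Y] [NormedSpace ℂ Y]
    {S T : Lp X 1 μ →L[ℂ] Lp X 1 μ →L[ℂ] Y}
    (h : ∀ u a v b, S (tmulL1 μ u a) (tmulL1 μ v b) = T (tmulL1 μ u a) (tmulL1 μ v b)) : S = T :=
  ext_tmulL1 fun u a => ext_tmulL1 fun v b => h u a v b

/-- Both sides are continuous and bilinear, so tensors u ⊗ m, v ⊗ n suffice. There each side, at F,
unfolds to m(a ↦ n(b ↦ F((u * v) ⊗ B a b))). -/
lemma map_conv_arensBox [μ.IsHaarMeasure] [μ.Regular]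
    {θ : Lp (Bidual E) 1 μ →L[ℂ] Bidual (Lp E 1 μ)}
    (hθ : ∀ (u : Lp ℂ 1 μ) (m : Bidual E) (F : StrongDual ℂ (Lp E 1 μ)),
      θ (tmulL1 μ u m) F = m (F.comp (tmulL1 μ u)))
    (B : E →L[ℂ] E →L[ℂ] E) (φ ψ : Lp (Bidual E) 1 μ) :
    θ (conv μ (arensBox B) φ ψ) = arensBox (conv μ B) (θ φ) (θ ψ) := by
  have : (ContinuousLinearMap.compL ℂ _ _ _ θ).comp (conv μ (arensBox B)) =
      (arensBox (conv μ B)).bilinearComp θ θ := by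
    refine bilinear_ext_tmulL1 fun u m v n => ?_
    ext F
    change θ (conv μ (arensBox B) (tmulL1 μ u m) (tmulL1 μ v n)) F =
      arensBox (conv μ B) (θ (tmulL1 μ u m)) (θ (tmulL1 μ v n)) F
    rw [conv_tmulL1, hθ, arensBox_apply, arensBox_apply, hθ]
    congr 1
    ext a
    simp only [ContinuousLinearMap.comp_apply]
    rw [hθ]
    congr 1
    ext b
    simp only [ContinuousLinearMap.comp_apply, rightTr_apply, conv_tmulL1]
  exact congrArg (fun T => T φ ψ) this

/-- As for the first product, the common value on tensors now being n(b ↦ m(a ↦ F((u * v) ⊗ B a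
b))). -/
lemma map_conv_arensDiamond [μ.IsHaarMeasure] [μ.Regular]
    {θ : Lp (Bidual E) 1 μ →L[ℂ] Bidual (Lp E 1 μ)}
    (hθ : ∀ (u : Lp ℂ 1 μ) (m : Bidual E) (F : StrongDual ℂ (Lp E 1 μ)),
      θ (tmulL1 μ u m) F = m (F.comp (tmulL1 μ u)))
    (B : E →L[ℂ] E →L[ℂ] E) (φ ψ : Lp (Bidual E) 1 μ) :
    θ (conv μ (arensDiamond B) φ ψ) = arensDiamond (conv μ B) (θ φ) (θ ψ) := by
  have : (ContinuousLinearMap.compL ℂ _ _ _ θ).comp (conv μ (arensDiamond B)) =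
      (arensDiamond (conv μ B)).bilinearComp θ θ := by
    refine bilinear_ext_tmulL1 fun u m v n => ?_
    ext F
    change θ (conv μ (arensDiamond B) (tmulL1 μ u m) (tmulL1 μ v n)) F =
      arensDiamond (conv μ B) (θ (tmulL1 μ u m)) (θ (tmulL1 μ v n)) F
    rw [conv_tmulL1, hθ, arensDiamond_apply, arensDiamond_apply, hθ]
    congr 1
    ext a
    simp only [ContinuousLinearMap.comp_apply]
    rw [hθ]
    congr 1
    ext b
    simp only [ContinuousLinearMap.comp_apply, leftTr_apply, conv_tmulL1]
  exact congrArg (fun T => T φ ψ) this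

end IntegrationMap
end ArensGroup

theorem mainTheorem8 {G : Type u} [TopologicalSpace G] [Group G] [IsTopologicalGroup G]
    [LocallyCompactSpace G] [T2Space G] [MeasurableSpace G] [BorelSpace G]
    (μ : Measure G) [μ.IsHaarMeasure] [μ.Regular]
    {A : Type v} [NonUnitalNormedRing A] [NormedSpace ℂ A] [IsScalarTower ℂ A A]
    [SMulCommClass ℂ A A] [CompleteSpace A]
    (hRNP : HasRNP.{u, v} (StrongDual ℂ A)) :
    -- every functional on `L¹(G, A)` is given by an element of `L^∞(G, A*)`
    (∀ F : StrongDual ℂ (Lp A 1 μ),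
      ∃ (f : G → StrongDual ℂ A) (hf : MemLinfty μ f), F = hf.functional) ∧
    -- the integration map is well defined, linear, isometric, and multiplicative
    ∃ θ : Lp (Bidual A) 1 μ →ₗᵢ[ℂ] Bidual (Lp A 1 μ),
      (∀ η : Lp (Bidual A) 1 μ → Bidual (Lp A 1 μ), IsIntegrationMap μ η ↔ η = θ) ∧
      (∀ φ ψ : Lp (Bidual A) 1 μ,
        θ (conv μ (arensBox (ContinuousLinearMap.mul ℂ A)) φ ψ) =
          arensBox (conv μ (ContinuousLinearMap.mul ℂ A)) (θ φ) (θ ψ)) ∧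
      (∀ φ ψ : Lp (Bidual A) 1 μ,
        θ (conv μ (arensDiamond (ContinuousLinearMap.mul ℂ A)) φ ψ) =
          arensDiamond (conv μ (ContinuousLinearMap.mul ℂ A)) (θ φ) (θ ψ)) := by
  obtain ⟨θ, hθ, htm⟩ := hRNP.exists_integrationMap (μ := μ)
  have hrep : ∀ F : StrongDual ℂ (Lp A 1 μ),
      ∃ (f : G → StrongDual ℂ A) (hf : MemLinfty μ f), F = hf.functional := fun F => by
    obtain ⟨f, hf, hF, -⟩ := hRNP.exists_functional_eq F
    exact ⟨f, hf, hF⟩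
  refine ⟨hrep, θ, fun η => ⟨fun hη => ?_, fun hη => hη ▸ hθ⟩, fun φ ψ => ?_, fun φ ψ => ?_⟩
  -- Uniqueness needs no linearity of η: every F comes from some f, so the integral formula fixes
  -- all values.
  · ext φ F
    obtain ⟨f, hf, rfl⟩ := hrep F
    rw [hη, hθ]
  · exact map_conv_arensBox (θ := θ.toContinuousLinearMap) htm _ φ ψ
  · exact map_conv_arensDiamond (θ := θ.toContinuousLinearMap) htm _ φ ψ
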